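/- Let $\Bbbk$ be an algebraically closed field of characteristic $0$, let $n,w$ be positive integers and $\gamma\in\Bbbk$ a primitive $n$-th root of unity. Let $H=B(n,w,\gamma)$ be the generalized Liu algebra: the Hopf algebra generated by $x^{\pm1},g,y$ with relations $$xx^{-1}=x^{-1}x=1,\quad xg=gx,\quad xy=yx,\quad yg=\gamma gy,\quad y^n=1-x^w=1-g^n,$$ where $x,g$ are group-like, $\Delta(y)=y\otimes g+1\otimes y$, $\varepsilon(y)=0$, $S(x)=x^{-1}$, $S(g)=g^{-1}$, $S(y)=-yg^{-1}$. Let $\alpha,\beta\in\Bbbk^*$ and $r,i\in\mathbb Z$ with $\alpha^w=\beta^n$, and let $V(\alpha,\beta,x^rg^i)$ be the following left-left Yetter-Drinfeld module over $H$. It has a basis $v_0,\dots,v_m$, where $m=n-1$ if $\beta^n\neq1$, and $m=n-\phi(-i-j)$ if $\beta=\gamma^j$ with $j\in\mathbb Z$; here $\phi(a)\in\{1,\dots,n\}$ is the integer congruent to $a$ modulo $n$. The action is $$x\cdot v_a=\alpha v_a,\qquad g\cdot v_a=\beta\gamma^{-a}v_a,\qquad y\cdot v_a=v_{a+1}\ (a<m),\qquad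 y\cdot v_m=(1-\beta^n)v_0,$$ and the coaction is $\delta(v_a)=\sum_{l=0}^a c(a,l)\otimes v_l$, where $c(0,0)=x^rg^i$ and, with the convention $c(a,l)=0$ for $l<0$ or $l>a$, $$c(a+1,l)=c(a,l)S(y)+\beta\gamma^{-l}\,y\,c(a,l)S(g)+c(a,l-1)S(g)\qquad(0\le l\le a+1).$$ For a Yetter-Drinfeld module $V$ over $H$ the Nichols algebra is $\mathcal B(V)=T(V)/\bigoplus_{N\ge2}\ker\Delta_{1^N}$. Here $\Delta\colon T(V)\to T(V)\otimes T(V)$ is the algebra map into the braided tensor product algebra with $\Delta(v)=v\otimes1+1\otimes v$ for $v\in V$, and $\Delta_{1^N}\colon V^{\otimes N}\to V^{\otimes N}$ is the restriction to $V^{\otimes N}$ of $\pi_1^{\otimes N}\circ\Delta^{N-1}$, where $\Delta^{N-1}\colon T(V)\to T(V)^{\otimes N}$ is the iterated comultiplication and $\pi_1\colon T(V)\to V$ is the projection onto degree one. If neither $\alpha$ nor $\beta$ is a root of unity, then the Nichols algebra $\mathcal B(V(\alpha,\beta,x^rg^i))$ is infinite-dimensional. -/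

import Mathlib

open scoped TensorProduct

namespace LiuYD

section GaussBinomial
variable {k : Type*} [Field k]

/-- The Gaussian binomial coefficients `binom(m, l)_q`. -/
def gaussBinom (q : k) : ℕ → ℕ → k
  | _, 0 => 1
  | 0, _ + 1 => 0
  | m + 1, l + 1 => gaussBinom q m l + q ^ (l + 1) * gaussBinom q m (l + 1)

@[simp] lemma gaussBinom_zero_right (q : k) (m : ℕ) : gaussBinom q m 0 = 1 := by
  cases m <;> rfl

lemma gaussBinom_succ (q : k) (m l : ℕ) : gaussBinom q (m + 1) (l + 1) =
    gaussBinom q m l + q ^ (l + 1) * gaussBinom q m (l + 1) := rfl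

lemma gaussBinom_lt (q : k) : ∀ {m l : ℕ}, m < l → gaussBinom q m l = 0
  | _, 0, h => absurd h (Nat.not_lt_zero _)
  | 0, _ + 1, _ => rfl
  | m + 1, l + 1, h => by
    rw [gaussBinom_succ, gaussBinom_lt q (by omega : m < l),
      gaussBinom_lt q (by omega : m < l + 1)]
    ring

@[simp] lemma gaussBinom_self (q : k) : ∀ m : ℕ, gaussBinom q m m = 1
  | 0 => rfl
  | m + 1 => by
    rw [gaussBinom_succ, gaussBinom_self q m, gaussBinom_lt q (by omega : m < m + 1)]
    ring

lemma gaussBinom_succ' (q : k) (d : ℕ) : ∀ (l : ℕ), gaussBinom q (l + d + 1) (l + 1) =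
    gaussBinom q (l + d) (l + 1) + q ^ d * gaussBinom q (l + d) l := by
  suffices h : ∀ m l d : ℕ, m = l + d → gaussBinom q (m + 1) (l + 1) =
    gaussBinom q m (l + 1) + q ^ d * gaussBinom q m l from fun l => h _ l d rfl
  intro m
  induction m with
  | zero =>
    intro l d h
    obtain rfl : l = 0 := by omega
    obtain rfl : d = 0 := by omega
    simp [gaussBinom]
  | succ m ih =>
    intro l d h
    rcases l with _ | l
    · obtain rfl : d = m + 1 := by omega
      have h1 := ih 0 m (by omega)
      have h2 := gaussBinom_succ q m 0
      rw [gaussBinom_succ, h1]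
      simp only [gaussBinom_zero_right, zero_add, pow_one] at h1 h2 ⊢
      linear_combination h1 - h2
    · rcases Nat.eq_zero_or_pos d with rfl | hd
      · obtain rfl : m = l := by omega
        simp [gaussBinom_lt q (by omega : m + 1 < m + 1 + 1)]
      · obtain ⟨e, rfl⟩ : ∃ e, d = e + 1 := ⟨d - 1, by omega⟩
        have h1 := ih l (e + 1) (by omega)
        have h2 := ih (l + 1) e (by omega)
        rw [gaussBinom_succ q (m + 1) (l + 1), h1, h2]
        have h3 := gaussBinom_succ q m l
        have h4 := gaussBinom_succ q m (l + 1)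
        linear_combination h2 - h4 + q ^ (e + 1) * (h1 - h3)

lemma gaussBinom_absorb (q : k) : ∀ m l : ℕ,
    (q ^ (l + 1) - 1) * gaussBinom q (m + 1) (l + 1) = (q ^ (m + 1) - 1) * gaussBinom q m l := by
  intro m
  induction m with
  | zero =>
    intro l
    rcases l with _ | l
    · simp [gaussBinom]
    · simp [gaussBinom]
  | succ m ih =>
    intro l
    have h1 := ih l
    rw [gaussBinom_succ q (m + 1) l]
    rcases l with _ | l
    · simp at h1 ⊢
      linear_combination q * h1
    · have h2 := ih l
      have h3 := gaussBinom_succ q m l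
      linear_combination q ^ (l + 2) * h1 + q * h2 - q * (q ^ (m + 1) - 1) * h3

lemma gaussBinom_eq_zero {q : k} {n : ℕ} (hq : IsPrimitiveRoot q n) {l : ℕ} (h0 : 0 < l)
    (hl : l < n) : gaussBinom q n l = 0 := by
  obtain ⟨l, rfl⟩ : ∃ e, l = e + 1 := ⟨l - 1, by omega⟩
  obtain ⟨n, rfl⟩ : ∃ e, n = e + 1 := ⟨n - 1, by omega⟩
  have h := gaussBinom_absorb q n l
  rw [hq.pow_eq_one, sub_self, zero_mul] at h
  exact (mul_eq_zero.1 h).resolve_left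
    (sub_ne_zero.2 (hq.pow_ne_one_of_pos_of_lt (by omega) hl))

variable {A : Type*} [Ring A] [Algebra k A]

lemma qcomm_pow {q : k} {a b : A} (h : b * a = q • (a * b)) (l : ℕ) :
    b * a ^ l = q ^ l • (a ^ l * b) := by
  induction l with
  | zero => simp
  | succ l ih =>
    rw [pow_succ, ← mul_assoc, ih, smul_mul_assoc, mul_assoc, h, mul_smul_comm, smul_smul,
      pow_succ, mul_assoc]

/-- The quantum binomial formula. -/
lemma add_pow_qcomm {q : k} {a b : A} (h : b * a = q • (a * b)) (m : ℕ) :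
    (a + b) ^ m = ∑ l ∈ Finset.range (m + 1), gaussBinom q m l • (a ^ l * b ^ (m - l)) := by
  induction m with
  | zero => simp
  | succ m ih =>
    rw [pow_succ', ih, Finset.sum_range_succ' _ (m + 1), add_mul]
    have hb : b * ∑ l ∈ Finset.range (m + 1), gaussBinom q m l • (a ^ l * b ^ (m - l)) =
        ∑ l ∈ Finset.range (m + 2), (q ^ l * gaussBinom q m l) • (a ^ l * b ^ (m + 1 - l)) := by
      rw [Finset.sum_range_succ _ (m + 1), gaussBinom_lt q (by omega : m < m + 1), Finset.mul_sum]
      simp only [mul_zero, zero_smul, add_zero]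
      refine Finset.sum_congr rfl fun l hl => ?_
      rw [Finset.mem_range] at hl
      rw [mul_smul_comm, ← mul_assoc, qcomm_pow h, smul_mul_assoc, smul_smul, mul_assoc,
        ← pow_succ', mul_comm, show m - l + 1 = m + 1 - l by omega]
    rw [hb, Finset.sum_range_succ' _ (m + 1), Finset.mul_sum, ← add_assoc, ← Finset.sum_add_distrib]
    congr 1
    · refine Finset.sum_congr rfl fun l hl => ?_
      rw [mul_smul_comm, ← mul_assoc, ← pow_succ', gaussBinom_succ, add_smul,
        show m + 1 - (l + 1) = m - l by omega]
    · simp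

lemma add_pow_primitive {q : k} {n : ℕ} (hn : 0 < n) (hq : IsPrimitiveRoot q n) {a b : A}
    (h : b * a = q • (a * b)) : (a + b) ^ n = a ^ n + b ^ n := by
  rw [add_pow_qcomm h, Finset.sum_range_succ]
  obtain ⟨n, rfl⟩ : ∃ e, n = e + 1 := ⟨n - 1, by omega⟩
  rw [Finset.sum_range_succ', Finset.sum_eq_zero]
  · simp [add_comm]
  · intro l hl
    rw [Finset.mem_range] at hl
    rw [gaussBinom_eq_zero hq (by omega) (by omega), zero_smul]

lemma neg_mul_pow_qcomm {q : k} {n : ℕ} (hn : 0 < n) (hq : IsPrimitiveRoot q n) {a b : A}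
    (h : b * a = q • (a * b)) : (-(a * b)) ^ n = -(a ^ n * b ^ n) := by
  have key : ∀ m : ℕ, (a * b) ^ m = q ^ (m * (m - 1) / 2) • (a ^ m * b ^ m) := by
    intro m
    induction m with
    | zero => simp
    | succ m ih =>
      have e : (m + 1) * (m + 1 - 1) / 2 = m + m * (m - 1) / 2 := by
        rw [← Finset.sum_range_id_mul_two, ← Finset.sum_range_id_mul_two,
          Nat.mul_div_cancel _ two_pos, Nat.mul_div_cancel _ two_pos, Finset.sum_range_succ,
          add_comm]
      rw [pow_succ', ih, e, mul_smul_comm, mul_assoc, ← mul_assoc b, qcomm_pow h, smul_mul_assoc,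
        mul_smul_comm, smul_smul, ← pow_add, add_comm m, ← mul_assoc, ← mul_assoc, ← pow_succ',
        mul_assoc, ← pow_succ']
  have hs : (-1 : k) ^ n * q ^ (n * (n - 1) / 2) = -1 := by
    rcases Nat.even_or_odd n with he | ho
    · obtain ⟨r, hr⟩ := he
      have h2 : q ^ r = -1 := by
        have h3 : (q ^ r) ^ 2 = 1 := by rw [← pow_mul, ← hq.pow_eq_one]; congr 1; omega
        exact (sq_eq_one_iff.1 h3).resolve_left
          (hq.pow_ne_one_of_pos_of_lt (by omega) (by omega))
      have e : n * (n - 1) / 2 = r * (n - 1) := by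
        rw [show n * (n - 1) = r * (n - 1) * 2 by rw [hr]; ring, Nat.mul_div_cancel _ two_pos]
      rw [e, pow_mul, h2, Even.neg_one_pow ⟨r, hr⟩, Odd.neg_one_pow ⟨r - 1, by omega⟩, one_mul]
    · obtain ⟨r, hr⟩ := ho
      have e : n * (n - 1) / 2 = n * r := by
        rw [show n * (n - 1) = n * r * 2 by rw [hr]; simp; ring, Nat.mul_div_cancel _ two_pos]
      rw [e, pow_mul, hq.pow_eq_one, one_pow, Odd.neg_one_pow ⟨r, hr⟩, mul_one]
  have hm : (-(a * b)) ^ n = (-1 : k) ^ n • (a * b) ^ n := by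
    rw [← smul_pow, neg_one_smul]
  rw [hm, key, smul_smul, hs, neg_one_smul]

end GaussBinomial


section GeneralizedLiu
variable {k : Type*} [Field k]

/-- The parameters of a generalized Liu algebra over `k`: positive integers `n`, `w` and a
primitive `n`-th root of unity `γ`. -/
structure LiuParam (k : Type*) [Field k] where
  n : ℕ
  w : ℕ
  γ : k
  n_pos : 0 < n
  w_pos : 0 < w
  prim : IsPrimitiveRoot γ n

/-- The four generators `x`, `x⁻¹`, `g`, `y`. -/
inductive LiuGen : Type
  | x
  | xInv
  | g
  | y

open FreeAlgebra in
/-- The defining relations of `B(n, w, γ)`. -/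
inductive LiuRel (P : LiuParam k) : FreeAlgebra k LiuGen → FreeAlgebra k LiuGen → Prop
  | x_mul_xInv : LiuRel P (ι k .x * ι k .xInv) 1
  | xInv_mul_x : LiuRel P (ι k .xInv * ι k .x) 1
  | x_mul_g : LiuRel P (ι k .x * ι k .g) (ι k .g * ι k .x)
  | x_mul_y : LiuRel P (ι k .x * ι k .y) (ι k .y * ι k .x)
  | y_mul_g : LiuRel P (ι k .y * ι k .g) (P.γ • (ι k .g * ι k .y))
  | y_pow : LiuRel P (ι k .y ^ P.n) (1 - ι k .x ^ P.w)
  | g_pow : LiuRel P (1 - ι k .x ^ P.w) (1 - ι k .g ^ P.n)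

/-- The generalized Liu algebra `B(n, w, γ)`. -/
def GenLiu (P : LiuParam k) : Type _ := RingQuot (LiuRel P)

namespace GenLiu

noncomputable instance (P : LiuParam k) : Ring (GenLiu P) :=
  inferInstanceAs (Ring (RingQuot (LiuRel P)))

noncomputable instance (P : LiuParam k) : Algebra k (GenLiu P) :=
  inferInstanceAs (Algebra k (RingQuot (LiuRel P)))

/-- The image of a generator in `B(n, w, γ)`. -/
noncomputable def gen (P : LiuParam k) (a : LiuGen) : GenLiu P :=
  RingQuot.mkAlgHom k (LiuRel P) (FreeAlgebra.ι k a)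

section
variable (P : LiuParam k)

/-- The generator `x`. -/
noncomputable abbrev x : GenLiu P := gen P .x
/-- The generator `x⁻¹`. -/
noncomputable abbrev xInv : GenLiu P := gen P .xInv
/-- The generator `g`. -/
noncomputable abbrev g : GenLiu P := gen P .g
/-- The generator `y`. -/
noncomputable abbrev y : GenLiu P := gen P .y

lemma x_mul_xInv : x P * xInv P = 1 := by
  simpa [gen] using! RingQuot.mkAlgHom_rel k (LiuRel.x_mul_xInv (P := P))

lemma xInv_mul_x : xInv P * x P = 1 := by
  simpa [gen] using! RingQuot.mkAlgHom_rel k (LiuRel.xInv_mul_x (P := P))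

lemma x_mul_g : x P * g P = g P * x P := by
  simpa [gen] using! RingQuot.mkAlgHom_rel k (LiuRel.x_mul_g (P := P))

lemma x_mul_y : x P * y P = y P * x P := by
  simpa [gen] using! RingQuot.mkAlgHom_rel k (LiuRel.x_mul_y (P := P))

lemma y_mul_g : y P * g P = P.γ • (g P * y P) := by
  simpa [gen] using! RingQuot.mkAlgHom_rel k (LiuRel.y_mul_g (P := P))

lemma y_pow : y P ^ P.n = 1 - x P ^ P.w := by
  simpa [gen] using! RingQuot.mkAlgHom_rel k (LiuRel.y_pow (P := P))

lemma g_pow : g P ^ P.n = x P ^ P.w := by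
  have h := RingQuot.mkAlgHom_rel k (LiuRel.g_pow (P := P))
  simp only [map_sub, map_one, map_pow] at h
  exact (sub_right_injective h).symm

end

variable {P : LiuParam k} {A : Type*} [Ring A] [Algebra k A]

variable (P) in
/-- The elements `f x`, `f x⁻¹`, `f g`, `f y` satisfy the relations of `B(n, w, γ)`. -/
structure Sat (f : LiuGen → A) : Prop where
  h₁ : f .x * f .xInv = 1
  h₂ : f .xInv * f .x = 1
  h₃ : f .x * f .g = f .g * f .x
  h₄ : f .x * f .y = f .y * f .x
  h₅ : f .y * f .g = P.γ • (f .g * f .y)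
  h₆ : f .y ^ P.n = 1 - f .x ^ P.w
  h₇ : 1 - f .x ^ P.w = 1 - f .g ^ P.n

/-- The universal property of `B(n, w, γ)`. -/
noncomputable def lift (f : LiuGen → A) (h : Sat P f) : GenLiu P →ₐ[k] A :=
  RingQuot.liftAlgHom k ⟨FreeAlgebra.lift k f, by
    obtain ⟨h₁, h₂, h₃, h₄, h₅, h₆, h₇⟩ := h
    intro a b hab
    cases hab <;> first | simpa | simpa using h₇⟩

lemma lift_gen (f : LiuGen → A) (h : Sat P f) (a : LiuGen) : lift f h (gen P a) = f a := by
  simpa [lift, gen] using!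
    RingQuot.liftAlgHom_mkAlgHom_apply k (FreeAlgebra.lift k f) _ (FreeAlgebra.ι k a)

lemma hom_ext {f f' : GenLiu P →ₐ[k] A} (h : ∀ a, f (gen P a) = f' (gen P a)) : f = f' := by
  refine RingQuot.ringQuot_ext' k (s := LiuRel P) f f' (FreeAlgebra.hom_ext ?_)
  funext a
  exact h a

lemma induction {C : GenLiu P → Prop} (halg : ∀ r : k, C (algebraMap k _ r))
    (hgen : ∀ a, C (gen P a)) (hmul : ∀ a b, C a → C b → C (a * b))
    (hadd : ∀ a b, C a → C b → C (a + b)) (a : GenLiu P) : C a := by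
  obtain ⟨a, rfl⟩ := RingQuot.mkAlgHom_surjective k (LiuRel P) a
  induction a using FreeAlgebra.induction with
  | grade0 r => rw [AlgHom.commutes]; exact halg r
  | grade1 a => exact hgen a
  | mul a b ha hb => rw [map_mul]; exact hmul _ _ ha hb
  | add a b ha hb => rw [map_add]; exact hadd _ _ ha hb

variable (P)

/-- The unit of `B(n, w, γ)` given by `x`. -/
noncomputable def xU : (GenLiu P)ˣ := ⟨x P, xInv P, x_mul_xInv P, xInv_mul_x P⟩

lemma commute_xU_g : Commute (xU P : GenLiu P) (g P) := x_mul_g P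
lemma commute_xU_y : Commute (xU P : GenLiu P) (y P) := x_mul_y P

/-- The unit of `B(n, w, γ)` given by `g`, whose inverse is `g ^ (n - 1) x ^ (-w)`. -/
noncomputable def gU : (GenLiu P)ˣ where
  val := g P
  inv := g P ^ (P.n - 1) * xInv P ^ P.w
  val_inv := by
    rw [← mul_assoc, ← pow_succ', Nat.sub_add_cancel P.n_pos, g_pow]
    exact (((xU P) ^ P.w).mul_inv)
  inv_val := by
    have h : Commute (xInv P) (g P) := (commute_xU_g P).units_inv_left
    rw [mul_assoc, (h.pow_left _).eq, ← mul_assoc, ← pow_succ, Nat.sub_add_cancel P.n_pos, g_pow]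
    exact (((xU P) ^ P.w).mul_inv)

/-- The inverse of `g`. -/
noncomputable abbrev gInv : GenLiu P := ((gU P)⁻¹ : (GenLiu P)ˣ)

lemma g_mul_gInv : g P * gInv P = 1 := (gU P).mul_inv
lemma gInv_mul_g : gInv P * g P = 1 := (gU P).inv_mul

lemma gInv_mul_y : gInv P * y P = P.γ • (y P * gInv P) := by
  calc gInv P * y P = gInv P * (y P * g P) * gInv P := by
        rw [mul_assoc, mul_assoc, g_mul_gInv, mul_one]
    _ = P.γ • (y P * gInv P) := by
        rw [y_mul_g, mul_smul_comm, ← mul_assoc, gInv_mul_g, one_mul, smul_mul_assoc]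

lemma commute_xInv_y : Commute (xInv P) (y P) := (commute_xU_y P).units_inv_left
lemma commute_xInv_g : Commute (xInv P) (g P) := (commute_xU_g P).units_inv_left
lemma commute_xInv_gInv : Commute (xInv P) (gInv P) :=
  ((show Commute (xU P : GenLiu P) (gU P) from commute_xU_g P).units_inv_left).units_inv_right

lemma gInv_pow : gInv P ^ P.n = xInv P ^ P.w := by
  have h : gU P ^ P.n = xU P ^ P.w := Units.ext (by simpa [gU, xU] using g_pow P)
  have h2 : (gU P)⁻¹ ^ P.n = (xU P)⁻¹ ^ P.w := by rw [inv_pow, h, inv_pow]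
  simpa using! congrArg Units.val h2

/-- The values of the comultiplication on generators: `x`, `g` are group-like and
`Δ(y) = y ⊗ g + 1 ⊗ y`. -/
noncomputable def comulGen : LiuGen → GenLiu P ⊗[k] GenLiu P
  | .x => x P ⊗ₜ x P
  | .xInv => xInv P ⊗ₜ xInv P
  | .g => g P ⊗ₜ g P
  | .y => y P ⊗ₜ g P + 1 ⊗ₜ y P

lemma comulGen_sat : Sat P (comulGen P) where
  h₁ := by simp [comulGen, x_mul_xInv, Algebra.TensorProduct.one_def]
  h₂ := by simp [comulGen, xInv_mul_x, Algebra.TensorProduct.one_def]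
  h₃ := by simp [comulGen, x_mul_g]
  h₄ := by simp [comulGen, x_mul_g, x_mul_y, mul_add, add_mul]
  h₅ := by simp [comulGen, y_mul_g, mul_add, add_mul, TensorProduct.smul_tmul']
  h₆ := by
      rw [comulGen, comulGen, add_pow_primitive P.n_pos P.prim (by simp [y_mul_g])]
      simp [y_pow, g_pow, Algebra.TensorProduct.one_def, TensorProduct.sub_tmul,
        TensorProduct.tmul_sub]
  h₇ := by simp [comulGen, g_pow]

/-- The comultiplication of `B(n, w, γ)`. -/
noncomputable def comulHom : GenLiu P →ₐ[k] GenLiu P ⊗[k] GenLiu P :=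
  lift (comulGen P) (comulGen_sat P)

/-- The values of the counit on generators. -/
def counitGen : LiuGen → k
  | .x => 1
  | .xInv => 1
  | .g => 1
  | .y => 0

lemma counitGen_sat : Sat P (counitGen (k := k)) where
  h₁ := by simp [counitGen]
  h₂ := by simp [counitGen]
  h₃ := by simp [counitGen]
  h₄ := by simp [counitGen]
  h₅ := by simp [counitGen]
  h₆ := by simp [counitGen, P.n_pos.ne']
  h₇ := by simp [counitGen]

/-- The counit of `B(n, w, γ)`. -/
noncomputable def counitHom : GenLiu P →ₐ[k] k :=
  lift (counitGen) (counitGen_sat P)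

@[simp] lemma comulHom_gen (a : LiuGen) : comulHom P (gen P a) = comulGen P a :=
  lift_gen ..
@[simp] lemma counitHom_gen (a : LiuGen) : counitHom P (gen P a) = counitGen a :=
  lift_gen ..

noncomputable instance : Bialgebra k (GenLiu P) :=
  Bialgebra.ofAlgHom (comulHom P) (counitHom P)
    (hom_ext fun a => by
      cases a <;>
        simp [comulGen, Algebra.TensorProduct.one_def, TensorProduct.add_tmul,
          TensorProduct.tmul_add, add_assoc])
    (hom_ext fun a => by cases a <;> simp [comulGen, counitGen])
    (hom_ext fun a => by cases a <;> simp [comulGen, counitGen])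

open Coalgebra

lemma comul_eq (a : GenLiu P) : comul (R := k) a = comulHom P a := rfl
lemma counit_eq (a : GenLiu P) : counit (R := k) a = counitHom P a := rfl

open MulOpposite in
/-- The values of the antipode on generators: `S(x) = x⁻¹`, `S(g) = g⁻¹`, `S(y) = -y g⁻¹`. -/
noncomputable def antipodeGen : LiuGen → (GenLiu P)ᵐᵒᵖ
  | .x => op (xInv P)
  | .xInv => op (x P)
  | .g => op (gInv P)
  | .y => op (-(y P * gInv P))

lemma antipodeGen_sat : Sat P (antipodeGen P) where
  h₁ := by simp [antipodeGen, ← MulOpposite.op_mul, x_mul_xInv]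
  h₂ := by simp [antipodeGen, ← MulOpposite.op_mul, xInv_mul_x]
  h₃ := by simp [antipodeGen, ← MulOpposite.op_mul, (commute_xInv_gInv P).eq]
  h₄ := by
      simp [antipodeGen, ← MulOpposite.op_mul, -MulOpposite.op_neg,
        ((commute_xInv_y P).mul_right (commute_xInv_gInv P)).eq]
  h₅ := by
      simp only [antipodeGen, ← MulOpposite.op_mul, ← MulOpposite.op_smul, mul_neg, neg_mul,
        smul_neg]
      rw [← mul_assoc, gInv_mul_y, smul_mul_assoc]
  h₆ := by
      simp only [antipodeGen, ← MulOpposite.op_pow]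
      rw [neg_mul_pow_qcomm P.n_pos P.prim (gInv_mul_y P), y_pow, gInv_pow, sub_mul, one_mul,
        show x P ^ P.w * xInv P ^ P.w = 1 from ((xU P) ^ P.w).mul_inv]
      simp
  h₇ := by
      simp only [antipodeGen, ← MulOpposite.op_pow]
      rw [gInv_pow]

/-- The antipode of `B(n, w, γ)` as an algebra map to the opposite algebra. -/
noncomputable def antipodeHom : GenLiu P →ₐ[k] (GenLiu P)ᵐᵒᵖ :=
  lift (antipodeGen P) (antipodeGen_sat P)

/-- The antipode of `B(n, w, γ)`. -/
noncomputable def antipodeLin : GenLiu P →ₗ[k] GenLiu P :=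
  (MulOpposite.opLinearEquiv k).symm.toLinearMap ∘ₗ (antipodeHom P).toLinearMap

lemma antipodeLin_gen (a : LiuGen) :
    antipodeLin P (gen P a) = (antipodeGen P a).unop := by
  exact congrArg MulOpposite.unop (lift_gen ..)

lemma antipodeLin_mul (a b : GenLiu P) :
    antipodeLin P (a * b) = antipodeLin P b * antipodeLin P a := by
  simp [antipodeLin]

lemma antipodeLin_one : antipodeLin P 1 = 1 := by
  simp [antipodeLin]

noncomputable instance : HopfAlgebra k (GenLiu P) where
  antipode := antipodeLin P
  mul_antipode_rTensor_comul := by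
    have key : ∀ (s t : GenLiu P ⊗[k] GenLiu P) (r : k),
        LinearMap.mul' k _ ((antipodeLin P).rTensor _ s) = algebraMap k _ r →
        LinearMap.mul' k _ ((antipodeLin P).rTensor _ (s * t)) =
          algebraMap k _ r * LinearMap.mul' k _ ((antipodeLin P).rTensor _ t) := by
      intro s t r hs
      induction t using TensorProduct.induction_on with
      | zero => simp
      | add t t' ht ht' => rw [mul_add, map_add, map_add, ht, ht', map_add, map_add, mul_add]
      | tmul a b =>
        have h : LinearMap.mul' k _ ((antipodeLin P).rTensor _ (s * a ⊗ₜ b)) =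
            antipodeLin P a * LinearMap.mul' k _ ((antipodeLin P).rTensor _ s) * b := by
          clear hs
          induction s using TensorProduct.induction_on with
          | zero => simp
          | add s s' hs hs' =>
            rw [add_mul, map_add, map_add, hs, hs', map_add, map_add, mul_add, add_mul]
          | tmul c d => simp [antipodeLin_mul, mul_assoc]
        rw [h, hs]
        simp [← Algebra.commutes, mul_assoc]
    refine LinearMap.ext fun a => ?_
    induction a using induction with
    | halg r =>
      simp [Algebra.algebraMap_eq_smul_one, Algebra.TensorProduct.one_def, antipodeLin_one]
    | hgen a =>
      cases a <;> simp [comul_eq, counit_eq, comulGen, counitGen, antipodeLin_gen, antipodeGen,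
        antipodeLin_one, x_mul_xInv, xInv_mul_x, gInv_mul_g, mul_assoc]
    | hmul a b ha hb =>
      simp only [LinearMap.comp_apply] at ha hb ⊢
      rw [Bialgebra.comul_mul, key _ _ _ ha, hb]
      simp
    | hadd a b ha hb => rw [map_add, ha, hb, map_add]
  mul_antipode_lTensor_comul := by
    have key : ∀ (s t : GenLiu P ⊗[k] GenLiu P) (r : k),
        LinearMap.mul' k _ ((antipodeLin P).lTensor _ t) = algebraMap k _ r →
        LinearMap.mul' k _ ((antipodeLin P).lTensor _ (s * t)) =
          LinearMap.mul' k _ ((antipodeLin P).lTensor _ s) * algebraMap k _ r := by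
      intro s t r ht
      induction s using TensorProduct.induction_on with
      | zero => simp
      | add s s' hs hs' => rw [add_mul, map_add, map_add, hs, hs', map_add, map_add, add_mul]
      | tmul a b =>
        have h : LinearMap.mul' k _ ((antipodeLin P).lTensor _ (a ⊗ₜ b * t)) =
            a * LinearMap.mul' k _ ((antipodeLin P).lTensor _ t) * antipodeLin P b := by
          clear ht
          induction t using TensorProduct.induction_on with
          | zero => simp
          | add s s' hs hs' =>
            rw [mul_add, map_add, map_add, hs, hs', map_add, map_add, mul_add, add_mul]
          | tmul c d => simp [antipodeLin_mul, mul_assoc]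
        rw [h, ht]
        simp [Algebra.commutes, mul_assoc]
    refine LinearMap.ext fun a => ?_
    induction a using induction with
    | halg r =>
      simp [Algebra.algebraMap_eq_smul_one, Algebra.TensorProduct.one_def, antipodeLin_one]
    | hgen a =>
      cases a <;> simp [comul_eq, counit_eq, comulGen, counitGen, antipodeLin_gen, antipodeGen,
        x_mul_xInv, xInv_mul_x, g_mul_gInv]
    | hmul a b ha hb =>
      simp only [LinearMap.comp_apply] at ha hb ⊢
      rw [Bialgebra.comul_mul, key _ _ _ hb, ha]
      simp
    | hadd a b ha hb => rw [map_add, ha, hb, map_add]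

open HopfAlgebra

lemma antipode_gen (a : LiuGen) : antipode k (gen P a) = (antipodeGen P a).unop :=
  antipodeLin_gen P a

end GenLiu
end GeneralizedLiu

section YetterDrinfeld
open Coalgebra HopfAlgebra

section
variable (k H V : Type*) [Field k] [Ring H] [HopfAlgebra k H]
  [AddCommGroup V] [Module k V] [Module H V] [IsScalarTower k H V]

/-- The linear map `H ⊗ (H ⊗ H) → End (H ⊗ V)` sending `a ⊗ (b ⊗ c)` to
`u ⊗ v ↦ a u S(c) ⊗ b • v`. -/
noncomputable def ydTriple : H ⊗[k] (H ⊗[k] H) →ₗ[k] Module.End k (H ⊗[k] V) :=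
  TensorProduct.homTensorHomMap (RingHom.id k) H V H V ∘ₗ
    TensorProduct.map
      (TensorProduct.lift ((LinearMap.mul k (Module.End k H)).compl₁₂
        (LinearMap.mul k H) ((LinearMap.mul k H).flip ∘ₗ antipode k)))
      (Algebra.lsmul k k V).toLinearMap ∘ₗ
    (TensorProduct.assoc k H H H).symm.toLinearMap ∘ₗ
    (TensorProduct.comm k H H).toLinearMap.lTensor H

variable {k H V} in
@[simp] lemma ydTriple_tmul (a b c u : H) (v : V) :
    ydTriple k H V (a ⊗ₜ (b ⊗ₜ c)) (u ⊗ₜ v) = (a * (u * antipode k c)) ⊗ₜ (b • v) := by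
  simp [ydTriple]

/-- For `h : H` the map `H ⊗ V → H ⊗ V`,
`u ⊗ v ↦ h₍₁₎ u S(h₍₃₎) ⊗ h₍₂₎ • v`. -/
noncomputable def ydTwist : H →ₗ[k] Module.End k (H ⊗[k] V) :=
  ydTriple k H V ∘ₗ (comul (R := k) (A := H)).lTensor H ∘ₗ comul

variable {k H V} in
lemma ydTriple_mul (s t : H ⊗[k] (H ⊗[k] H)) :
    ydTriple k H V (s * t) = ydTriple k H V s * ydTriple k H V t := by
  have h : (LinearMap.mul k (H ⊗[k] (H ⊗[k] H))).compr₂ (ydTriple k H V) =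
      (LinearMap.mul k (Module.End k (H ⊗[k] V))).compl₁₂ (ydTriple k H V) (ydTriple k H V) := by
    ext a b c a' b' c' u v
    simp [HopfAlgebra.antipode_mul_antidistrib, mul_assoc, mul_smul]
  exact LinearMap.congr_fun₂ h s t

variable {k H V} in
lemma ydTwist_mul (a b : H) : ydTwist k H V (a * b) = ydTwist k H V a * ydTwist k H V b := by
  have h : ∀ s t : H ⊗[k] H, (comul (R := k) (A := H)).lTensor H (s * t) =
      (comul (R := k) (A := H)).lTensor H s * (comul (R := k) (A := H)).lTensor H t :=
    map_mul (Algebra.TensorProduct.map (AlgHom.id k H) (Bialgebra.comulAlgHom k H))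
  simp only [ydTwist, LinearMap.comp_apply, Bialgebra.comul_mul, h, ydTriple_mul]

variable {k H V} in
lemma ydTwist_one : ydTwist k H V 1 = 1 := by
  refine TensorProduct.ext' fun u v => ?_
  simp [ydTwist, Algebra.TensorProduct.one_def]

/-- A (left-left) Yetter-Drinfeld module over the Hopf algebra `H`: a left `H`-module `V` with a
left `H`-comodule structure `coact` satisfying
`δ(h • v) = h₍₁₎ v₍₋₁₎ S(h₍₃₎) ⊗ h₍₂₎ • v₍₀₎`. -/
class YetterDrinfeld where
  /-- The coaction `δ : V → H ⊗ V`. -/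
  coact : V →ₗ[k] H ⊗[k] V
  coassoc : (TensorProduct.assoc k H H V).toLinearMap ∘ₗ
    (comul (R := k) (A := H)).rTensor V ∘ₗ coact = coact.lTensor H ∘ₗ coact
  counit_coact : (TensorProduct.lid k V).toLinearMap ∘ₗ
    (counit (R := k) (A := H)).rTensor V ∘ₗ coact = LinearMap.id
  compat : ∀ (h : H) (v : V), coact (h • v) = ydTwist k H V h (coact v)

end

/-! ### The braided tensor algebra of a Yetter-Drinfeld module -/

section
variable (k H V : Type*) [Field k] [Ring H] [HopfAlgebra k H]
  [AddCommGroup V] [Module k V] [Module H V] [IsScalarTower k H V]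

/-- The diagonal action of `H` on `T(V)`: the unique one extending the action on `V` with
`h • (s t) = (h₍₁₎ • s) (h₍₂₎ • t)` and `h • 1 = ε(h) 1`, that is, such that
`t ↦ (h ↦ h • t)` is an algebra map to the convolution algebra `Hom(H, T(V))`. -/
noncomputable def tensorActConv :
    TensorAlgebra k V →ₐ[k] WithConv (H →ₗ[k] TensorAlgebra k V) :=
  TensorAlgebra.lift k ((WithConv.linearEquiv k (H →ₗ[k] TensorAlgebra k V)).symm.toLinearMap ∘ₗ
    (Algebra.lsmul k k V).toLinearMap.flip.compr₂ (TensorAlgebra.ι k))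

/-- The diagonal action of `H` on `T(V)` as a bilinear map. -/
noncomputable def tensorAct : H →ₗ[k] TensorAlgebra k V →ₗ[k] TensorAlgebra k V :=
  ((WithConv.linearEquiv k (H →ₗ[k] TensorAlgebra k V)).toLinearMap ∘ₗ
    (tensorActConv k H V).toLinearMap).flip

variable [YetterDrinfeld k H V]

/-- The coaction of `H` on `T(V)`: the algebra map `T(V) → H ⊗ T(V)` extending the coaction on
`V`. -/
noncomputable def tensorCoact : TensorAlgebra k V →ₐ[k] H ⊗[k] TensorAlgebra k V :=
  TensorAlgebra.lift k ((TensorAlgebra.ι k).lTensor H ∘ₗ YetterDrinfeld.coact)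

/-- The braiding `c : T(V) ⊗ T(V) → T(V) ⊗ T(V)`, `s ⊗ t ↦ s₍₋₁₎ • t ⊗ s₍₀₎`. -/
noncomputable def tensorBraiding :
    TensorAlgebra k V ⊗[k] TensorAlgebra k V →ₗ[k] TensorAlgebra k V ⊗[k] TensorAlgebra k V :=
  (TensorProduct.lift (tensorAct k H V)).rTensor _ ∘ₗ
    (TensorProduct.assoc k H _ _).symm.toLinearMap ∘ₗ
    (TensorProduct.comm k _ _).toLinearMap.lTensor H ∘ₗ
    (TensorProduct.assoc k H _ _).toLinearMap ∘ₗ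
    (tensorCoact k H V).toLinearMap.rTensor _

/-- The multiplication of the braided tensor product algebra `T(V) ⊗ T(V)`:
`(a ⊗ b) (a' ⊗ b') = a (b₍₋₁₎ • a') ⊗ b₍₀₎ b'`. -/
noncomputable def braidedMul :
    TensorAlgebra k V ⊗[k] TensorAlgebra k V →ₗ[k]
      TensorAlgebra k V ⊗[k] TensorAlgebra k V →ₗ[k]
        TensorAlgebra k V ⊗[k] TensorAlgebra k V :=
  TensorProduct.curry
    (TensorProduct.map (LinearMap.mul' k _) (LinearMap.mul' k _) ∘ₗ
      (TensorProduct.assoc k _ _ _).symm.toLinearMap ∘ₗ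
      ((TensorProduct.assoc k _ _ _).toLinearMap ∘ₗ (tensorBraiding k H V).rTensor _ ∘ₗ
        (TensorProduct.assoc k _ _ _).symm.toLinearMap).lTensor _ ∘ₗ
      (TensorProduct.assoc k _ _ _).toLinearMap)

/-- The comultiplication `Δ` of `T(V)`: the algebra map from `T(V)` to the braided tensor product
algebra with `Δ(v) = v ⊗ 1 + 1 ⊗ v`. It is obtained by letting `T(V)` act on `T(V) ⊗ T(V)` so that
each `v : V` acts as left multiplication by `v ⊗ 1 + 1 ⊗ v`, and evaluating at `1 ⊗ 1`;
so `Δ(1) = 1 ⊗ 1` and `Δ(v t) = (v ⊗ 1 + 1 ⊗ v) Δ(t)`. -/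
noncomputable def tensorComul :
    TensorAlgebra k V →ₗ[k] TensorAlgebra k V ⊗[k] TensorAlgebra k V :=
  (LinearMap.applyₗ (1 ⊗ₜ 1)) ∘ₗ
    (TensorAlgebra.lift k (A := Module.End k (TensorAlgebra k V ⊗[k] TensorAlgebra k V))
      (braidedMul k H V ∘ₗ
        ((TensorProduct.mk k _ _).flip 1 ∘ₗ TensorAlgebra.ι k +
          TensorProduct.mk k _ _ 1 ∘ₗ TensorAlgebra.ι k))).toLinearMap

lemma tensorComul_one : tensorComul k H V 1 = 1 ⊗ₜ 1 := by
  simp [tensorComul]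

lemma tensorComul_ι_mul (v : V) (t : TensorAlgebra k V) :
    tensorComul k H V (TensorAlgebra.ι k v * t) =
      braidedMul k H V (TensorAlgebra.ι k v ⊗ₜ 1 + 1 ⊗ₜ TensorAlgebra.ι k v)
        (tensorComul k H V t) := by
  simp [tensorComul]

end

section
variable (k : Type*) [Field k] {C : Type*} [AddCommGroup C] [Module k C]

/-- The map `C ⊗ C^{⊗ m} → C^{⊗ (m + 1)}`, `c ⊗ (c₁ ⊗ ⋯ ⊗ cₘ) ↦ c ⊗ c₁ ⊗ ⋯ ⊗ cₘ`. -/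
noncomputable def tensorCons (m : ℕ) :
    C ⊗[k] (PiTensorProduct k fun _ : Fin m => C) →ₗ[k]
      PiTensorProduct k fun _ : Fin (m + 1) => C :=
  TensorProduct.lift ((PiTensorProduct.lift :
      MultilinearMap k (fun _ : Fin m => C) (PiTensorProduct k fun _ : Fin (m + 1) => C) ≃ₗ[k] _
      ).toLinearMap ∘ₗ
    (PiTensorProduct.tprod k : MultilinearMap k (fun _ : Fin (m + 1) => C) _).curryLeft)

lemma tensorCons_tmul_tprod (m : ℕ) (c : C) (f : Fin m → C) :
    tensorCons k m (c ⊗ₜ PiTensorProduct.tprod k f) = PiTensorProduct.tprod k (Fin.cons c f) := by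
  simp [tensorCons]

variable {k} in
/-- The iterated comultiplication `Δ^m : C → C^{⊗ (m + 1)}`, with `Δ^0 = id` and
`Δ^{m + 1} = (id ⊗ Δ^m) Δ`. -/
noncomputable def iterComul (Δ : C →ₗ[k] C ⊗[k] C) :
    (m : ℕ) → C →ₗ[k] PiTensorProduct k fun _ : Fin (m + 1) => C
  | 0 => (PiTensorProduct.subsingletonEquiv (R := k) (s := fun _ : Fin 1 => C) 0).symm.toLinearMap
  | m + 1 => tensorCons k (m + 1) ∘ₗ (iterComul Δ m).lTensor C ∘ₗ Δ

end

section
variable (k H V : Type*) [Field k] [Ring H] [HopfAlgebra k H]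
  [AddCommGroup V] [Module k V] [Module H V] [IsScalarTower k H V] [YetterDrinfeld k H V]

/-- The map `π₁^{⊗ (m + 1)} Δ^m : T(V) → V^{⊗ (m + 1)}`, whose restriction to the homogeneous
component of degree `m + 1` is `Δ_{1^{m + 1}}`; the projection `π₁` of `T(V)` onto its component `V`
of degree one is `TensorAlgebra.ιInv`. -/
noncomputable def deltaOne (m : ℕ) :
    TensorAlgebra k V →ₗ[k] PiTensorProduct k fun _ : Fin (m + 1) => V :=
  PiTensorProduct.map (fun _ => TensorAlgebra.ιInv) ∘ₗ iterComul (tensorComul k H V) m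

/-- The homogeneous component of degree `m` of `T(V)`. -/
noncomputable def tensorDegree (m : ℕ) : Submodule k (TensorAlgebra k V) :=
  LinearMap.range (TensorAlgebra.ι k : V →ₗ[k] TensorAlgebra k V) ^ m

/-- The defining ideal `⨁_{m ≥ 2} ker Δ_{1^m}` of the Nichols algebra, where `Δ_{1^m}` is
considered on the component of degree `m`; here `m = j + 2`. -/
noncomputable def nicholsIdeal : Submodule k (TensorAlgebra k V) :=
  ⨆ j : ℕ, tensorDegree k V (j + 2) ⊓ LinearMap.ker (deltaOne k H V (j + 1))

/-- The Nichols algebra `B(V) = T(V) / ⨁_{m ≥ 2} ker Δ_{1^m}` of a Yetter-Drinfeld module, as a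
vector space. -/
abbrev NicholsAlgebra : Type _ := TensorAlgebra k V ⧸ nicholsIdeal k H V

end
end YetterDrinfeld

section SimpleModules
variable {k : Type*} [Field k]

open GenLiu HopfAlgebra Coalgebra

/-- For `n ≥ 1` and an integer `a`, the unique element of `{1, …, n}` congruent to `a` modulo `n`. -/
def phi (n : ℕ) (a : ℤ) : ℕ := ((a - 1) % n + 1).toNat

lemma phi_spec {n : ℕ} (hn : 0 < n) (a : ℤ) :
    1 ≤ phi n a ∧ phi n a ≤ n ∧ ∃ t : ℤ, (phi n a : ℤ) = a + n * t := by
  have h1 := Int.emod_nonneg (a - 1) (by omega : (n : ℤ) ≠ 0)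
  have h2 := Int.emod_lt_of_pos (a - 1) (by omega : (0 : ℤ) < n)
  have h3 := Int.emod_add_mul_ediv (a - 1) n
  have h4 : (phi n a : ℤ) = (a - 1) % n + 1 := by rw [phi]; omega
  refine ⟨by omega, by omega, -((a - 1) / n), ?_⟩
  rw [h4]
  linear_combination h3

section Coefficients
variable (P : LiuParam k)

/-- The group-like element `x ^ r g ^ i` of `B(n, w, γ)`. -/
noncomputable def grpLike (r i : ℤ) : GenLiu P := ((xU P ^ r * gU P ^ i : (GenLiu P)ˣ) : GenLiu P)

/-- The elements `c_β^{r,i}(a, l)` of `B(n, w, γ)`, defined recursively for `0 ≤ l ≤ a`, and extended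
by `0` to `l > a`. -/
noncomputable def coef (β : k) (r i : ℤ) : ℕ → ℕ → GenLiu P
  | 0, 0 => grpLike P r i
  | 0, _ + 1 => 0
  | a + 1, 0 => coef β r i a 0 * antipode k (y P) +
      β • (y P * coef β r i a 0 * antipode k (g P))
  | a + 1, l + 1 => coef β r i a (l + 1) * antipode k (y P) +
      (β * (P.γ ^ (l + 1))⁻¹) • (y P * coef β r i a (l + 1) * antipode k (g P)) +
      coef β r i a l * antipode k (g P)

variable {P}

lemma antipode_x : antipode k (x P) = xInv P := antipode_gen P .x
lemma antipode_xInv : antipode k (xInv P) = x P := antipode_gen P .xInv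
lemma antipode_g : antipode k (g P) = gInv P := antipode_gen P .g
lemma antipode_y : antipode k (y P) = -(y P * gInv P) := antipode_gen P .y

variable (P) in
lemma γ_ne : P.γ ≠ 0 := P.prim.ne_zero P.n_pos.ne'

lemma coef_of_lt (β : k) (r i : ℤ) : ∀ {a l : ℕ}, a < l → coef P β r i a l = 0
  | _, 0, h => absurd h (Nat.not_lt_zero _)
  | 0, _ + 1, _ => by rw [coef]
  | a + 1, l + 1, h => by
    rw [coef, coef_of_lt β r i (by omega : a < l), coef_of_lt β r i (by omega : a < l + 1)]
    simp

lemma g_mul_y : g P * y P = P.γ⁻¹ • (y P * g P) := by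
  rw [y_mul_g, smul_smul, inv_mul_cancel₀ (γ_ne P), one_smul]

lemma gz_mul_y (a : ℤ) : ((gU P ^ a : (GenLiu P)ˣ) : GenLiu P) * y P =
    (P.γ ^ a)⁻¹ • (y P * ((gU P ^ a : (GenLiu P)ˣ) : GenLiu P)) := by
  induction a using Int.induction_on with
  | zero => simp
  | succ a ih =>
    rw [zpow_add_one, zpow_add_one₀ (γ_ne P), Units.val_mul, mul_assoc,
      show (gU P : GenLiu P) * y P = P.γ⁻¹ • (y P * (gU P : GenLiu P)) from g_mul_y,
      mul_smul_comm, ← mul_assoc, ih, smul_mul_assoc, smul_smul, mul_inv, mul_assoc, mul_comm P.γ⁻¹]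
  | pred a ih =>
    rw [zpow_sub_one, zpow_sub_one₀ (γ_ne P), Units.val_mul, mul_assoc, gInv_mul_y,
      mul_smul_comm, ← mul_assoc, ih, smul_mul_assoc, smul_smul, mul_inv, mul_assoc, inv_inv,
      mul_comm P.γ]

lemma x_central (h : GenLiu P) : Commute (x P) h := by
  induction h using GenLiu.induction with
  | halg r => exact (Algebra.commutes r _).symm
  | hgen a =>
    cases a
    · exact Commute.refl _
    · exact (x_mul_xInv P).trans (xInv_mul_x P).symm
    · exact x_mul_g P
    · exact x_mul_y P
  | hmul a b ha hb => exact ha.mul_right hb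
  | hadd a b ha hb => exact ha.add_right hb

lemma xz_central (r : ℤ) (h : GenLiu P) : Commute ((xU P ^ r : (GenLiu P)ˣ) : GenLiu P) h := by
  induction r using Int.induction_on with
  | zero => simp
  | succ r ih =>
    rw [zpow_add_one, Units.val_mul]
    exact ih.mul_left (x_central h)
  | pred r ih =>
    rw [zpow_sub_one, Units.val_mul]
    exact ih.mul_left (show Commute (xU P : GenLiu P) h from x_central h).units_inv_left

lemma grpLike_mul_gInv (r i : ℤ) : grpLike P r i * gInv P = grpLike P r (i - 1) := by
  rw [grpLike, grpLike, ← Units.val_mul, mul_assoc, zpow_sub_one]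

lemma grpLike_mul_y (r i : ℤ) : grpLike P r i * y P = (P.γ ^ i)⁻¹ • (y P * grpLike P r i) := by
  rw [grpLike, Units.val_mul, mul_assoc, gz_mul_y, mul_smul_comm, ← mul_assoc,
    (xz_central r (y P)).eq, mul_assoc]

/-- The scalars `λ_β^i(a, l)` in closed form. -/
noncomputable def lam (γ β : k) (i : ℤ) (a l : ℕ) : k :=
  gaussBinom γ a l * (γ ^ ((a - l) * l))⁻¹ * ∏ t ∈ Finset.Ico l a, (β - γ ^ (t - i : ℤ))

lemma lam_succ_zero (γ β : k) (i : ℤ) (a : ℕ) :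
    lam γ β i (a + 1) 0 = (β - γ ^ (a - i : ℤ)) * lam γ β i a 0 := by
  simp only [lam, gaussBinom_zero_right, mul_zero, pow_zero, inv_one, mul_one, one_mul]
  rw [Finset.prod_Ico_succ_top (Nat.zero_le _), mul_comm]

lemma lam_succ_succ {γ : k} (hγ : γ ≠ 0) (β : k) (i : ℤ) {a l : ℕ} (h : l ≤ a) :
    lam γ β i (a + 1) (l + 1) =
      (β * (γ ^ (l + 1))⁻¹ - γ ^ (a - i : ℤ)) * lam γ β i a (l + 1) + lam γ β i a l := by
  rcases h.eq_or_lt with rfl | h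
  · simp [lam, gaussBinom_lt γ (Nat.lt_succ_self l)]
  · obtain ⟨d, rfl⟩ : ∃ d, a = l + 1 + d := ⟨a - (l + 1), by omega⟩
    have h1 := gaussBinom_succ γ (l + 1 + d) l
    have h2 := gaussBinom_succ' γ (d + 1) l
    rw [show l + (d + 1) = l + 1 + d by omega] at h2
    simp only [lam]
    rw [Finset.prod_Ico_succ_top (by omega : l + 1 ≤ l + 1 + d),
      Finset.prod_eq_prod_Ico_succ_bot (by omega : l < l + 1 + d),
      show l + 1 + d + 1 - (l + 1) = d + 1 by omega, show l + 1 + d - (l + 1) = d by omega,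
      show l + 1 + d - l = d + 1 by omega]
    generalize ∏ t ∈ Finset.Ico (l + 1) (l + 1 + d), (β - γ ^ (t - i : ℤ)) = Q
    have e1 : γ ^ (((l + 1 + d : ℕ) : ℤ) - i) = γ ^ l * γ ^ (d + 1) * γ ^ (-i) := by
      rw [← pow_add, ← zpow_natCast γ, ← zpow_add₀ hγ]; congr 1; push_cast; ring
    have e2 : γ ^ ((l : ℤ) - i) = γ ^ l * γ ^ (-i) := by
      rw [← zpow_natCast γ, ← zpow_add₀ hγ]; congr 1
    have e3 : γ ^ ((d + 1) * (l + 1)) = γ ^ (d * l) * γ ^ d * γ ^ l * γ := by ring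
    have e4 : γ ^ (d * (l + 1)) = γ ^ (d * l) * γ ^ d := by ring
    have e5 : γ ^ ((d + 1) * l) = γ ^ (d * l) * γ ^ l := by ring
    rw [e1, e2, e3, e4, e5]
    rw [pow_succ γ l] at h1
    rw [pow_succ γ d] at h2
    have h3 : γ ^ l ≠ 0 := pow_ne_zero _ hγ
    have h4 : γ ^ d ≠ 0 := pow_ne_zero _ hγ
    have h5 : γ ^ (d * l) ≠ 0 := pow_ne_zero _ hγ
    rw [pow_succ γ l, pow_succ γ d]
    generalize γ ^ l = L at *
    generalize γ ^ d = D at *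
    generalize γ ^ (d * l) = E at *
    generalize γ ^ (-i) = I at *
    field_simp
    linear_combination Q * (β * h2 - L * D * γ * I * h1)

lemma coef_eq (β : k) (r i : ℤ) : ∀ a l : ℕ, l ≤ a →
    coef P β r i a l = lam P.γ β i a l • (y P ^ (a - l) * grpLike P r (i - a)) := by
  have hy : ∀ (a : ℕ) (u : GenLiu P), u * grpLike P r (i - a) * antipode k (y P) =
      -(P.γ ^ (a - i : ℤ)) • (u * y P * grpLike P r (i - (a + 1 : ℕ))) := by
    intro a u
    rw [antipode_y, mul_assoc, mul_neg, ← mul_assoc (grpLike P r _), grpLike_mul_y,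
      smul_mul_assoc, mul_assoc (y P), grpLike_mul_gInv, mul_neg, mul_smul_comm, ← mul_assoc,
      neg_smul, ← zpow_neg, neg_sub, Nat.cast_succ, sub_sub]
  have hg : ∀ (a : ℕ) (u : GenLiu P), u * grpLike P r (i - a) * antipode k (g P) =
      u * grpLike P r (i - (a + 1 : ℕ)) := by
    intro a u
    rw [antipode_g, mul_assoc, grpLike_mul_gInv, Nat.cast_succ, sub_sub]
  intro a
  induction a with
  | zero =>
    intro l hl
    obtain rfl : l = 0 := by omega
    simp [coef, lam]
  | succ a ih =>
    intro l hl
    rcases l with _ | l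
    · rw [coef, ih 0 (Nat.zero_le _), lam_succ_zero]
      simp only [smul_mul_assoc, mul_smul_comm]
      rw [hy, ← mul_assoc (y P), hg, Nat.sub_zero, Nat.sub_zero, ← pow_succ, ← pow_succ']
      module
    · have e : a + 1 - (l + 1) = a - l := by omega
      rw [coef, lam_succ_succ (γ_ne P) β i (by omega), ih l (by omega), e]
      rcases (show l = a ∨ l + 1 ≤ a by omega) with rfl | hl'
      · rw [coef_of_lt β r i (Nat.lt_succ_self l)]
        simp only [smul_mul_assoc]
        rw [hg]
        simp [lam, gaussBinom_lt P.γ (Nat.lt_succ_self l)]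
      · rw [ih (l + 1) hl']
        simp only [smul_mul_assoc, mul_smul_comm]
        rw [hy, ← mul_assoc (y P), hg, hg, ← pow_succ, ← pow_succ',
          show a - (l + 1) + 1 = a - l by omega]
        module

lemma prod_root (β : k) (i : ℤ) :
    ∏ t ∈ Finset.Ico 0 P.n, (β - P.γ ^ (t - i : ℤ)) = β ^ P.n - 1 := by
  have hne := γ_ne P
  have : NeZero P.n := ⟨P.n_pos.ne'⟩
  have h := congrArg (Polynomial.eval β) (Polynomial.X_pow_sub_one_eq_prod P.n_pos P.prim)
  simp only [Polynomial.eval_sub, Polynomial.eval_pow, Polynomial.eval_X, Polynomial.eval_one,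
    Polynomial.eval_prod, Polynomial.eval_C] at h
  rw [h]
  refine Finset.prod_bij (fun t _ => P.γ ^ (t - i : ℤ)) ?_ ?_ ?_ ?_
  · intro t _
    rw [Polynomial.mem_nthRootsFinset P.n_pos, ← zpow_natCast, ← zpow_mul, mul_comm, zpow_mul,
      zpow_natCast, P.prim.pow_eq_one, one_zpow]
  · intro s hs t ht hst
    rw [Finset.mem_Ico] at hs ht
    rw [zpow_sub₀ hne, zpow_sub₀ hne] at hst
    have := mul_right_cancel₀ (inv_ne_zero (zpow_ne_zero i hne)) (by simpa [div_eq_mul_inv] using hst)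
    exact P.prim.pow_inj hs.2 ht.2 (by exact_mod_cast this)
  · intro b hb
    rw [Polynomial.mem_nthRootsFinset P.n_pos] at hb
    have h1 : (b * P.γ ^ i) ^ P.n = 1 := by
      rw [mul_pow, hb, one_mul, ← zpow_natCast, ← zpow_mul, mul_comm, zpow_mul, zpow_natCast,
        P.prim.pow_eq_one, one_zpow]
    obtain ⟨t, ht, hb'⟩ := P.prim.eq_pow_of_pow_eq_one h1
    refine ⟨t, by simpa using ht, ?_⟩
    rw [zpow_sub₀ hne, zpow_natCast, hb', mul_div_assoc, div_self (zpow_ne_zero i hne), mul_one]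
  · intro t _; rfl

lemma g_mul_coef (β : k) (r i : ℤ) (a l : ℕ) :
    g P * coef P β r i a l = (P.γ ^ l * (P.γ ^ a)⁻¹) • (coef P β r i a l * g P) := by
  have hne := γ_ne P
  have hSy : g P * antipode k (y P) = P.γ⁻¹ • (antipode k (y P) * g P) := by
    rw [antipode_y, mul_neg, neg_mul, mul_assoc, gInv_mul_g, ← mul_assoc, g_mul_y, smul_mul_assoc,
      mul_assoc, g_mul_gInv, smul_neg]
  have hSg : g P * antipode k (g P) = antipode k (g P) * g P := by
    rw [antipode_g, g_mul_gInv, gInv_mul_g]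
  have t1 : ∀ (u : GenLiu P) (s : k), g P * u = s • (u * g P) →
      g P * (u * antipode k (y P)) = (s * P.γ⁻¹) • (u * antipode k (y P) * g P) := by
    intro u s hu
    rw [← mul_assoc, hu, smul_mul_assoc, mul_assoc, hSy, mul_smul_comm, smul_smul, mul_assoc]
  have t2 : ∀ (u : GenLiu P) (s : k), g P * u = s • (u * g P) →
      g P * (u * antipode k (g P)) = s • (u * antipode k (g P) * g P) := by
    intro u s hu
    rw [← mul_assoc, hu, smul_mul_assoc, mul_assoc, hSg, mul_assoc]
  have t3 : ∀ (u : GenLiu P) (s : k), g P * u = s • (u * g P) →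
      g P * (y P * u) = (s * P.γ⁻¹) • (y P * u * g P) := by
    intro u s hu
    rw [← mul_assoc, g_mul_y, smul_mul_assoc, mul_assoc, hu, mul_smul_comm, smul_smul, mul_assoc,
      mul_comm]
  have t4 : ∀ (u v : GenLiu P) (s : k), g P * u = s • (u * g P) → g P * v = s • (v * g P) →
      g P * (u + v) = s • ((u + v) * g P) := by
    intro u v s hu hv
    rw [mul_add, hu, hv, add_mul, smul_add]
  have t5 : ∀ (u : GenLiu P) (s c : k), g P * u = s • (u * g P) →
      g P * (c • u) = s • (c • u * g P) := by
    intro u s c hu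
    rw [mul_smul_comm, hu, smul_mul_assoc, smul_comm]
  induction a generalizing l with
  | zero =>
    rcases l with _ | l
    · rw [coef, grpLike]
      have h1 := (xz_central r (g P)).eq
      have h2 : (gU P : GenLiu P) * ((gU P ^ i : (GenLiu P)ˣ) : GenLiu P) =
          ((gU P ^ i : (GenLiu P)ˣ) : GenLiu P) * (gU P : GenLiu P) := by
        rw [← Units.val_mul, ← Units.val_mul, ((Commute.refl (gU P)).zpow_right i).eq]
      rw [Units.val_mul, ← mul_assoc, ← h1, mul_assoc]
      rw [show g P * _ = _ from h2, ← mul_assoc]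
      simp [gU]
    · simp [coef]
  | succ a ih =>
    have hs : ∀ l : ℕ, P.γ ^ l * (P.γ ^ (a + 1))⁻¹ = P.γ ^ l * (P.γ ^ a)⁻¹ * P.γ⁻¹ := by
      intro l; rw [pow_succ, mul_inv, mul_assoc]
    rcases l with _ | l
    · rw [coef, hs]
      exact t4 _ _ _ (t1 _ _ (ih 0)) (t5 _ _ _ (t2 _ _ (t3 _ _ (ih 0))))
    · rw [coef, hs]
      refine t4 _ _ _ (t4 _ _ _ (t1 _ _ (ih _)) (t5 _ _ _ (t2 _ _ (t3 _ _ (ih _))))) ?_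
      have : P.γ ^ (l + 1) * (P.γ ^ a)⁻¹ * P.γ⁻¹ = P.γ ^ l * (P.γ ^ a)⁻¹ := by
        field_simp
        ring
      rw [this]
      exact t2 _ _ (ih l)

end Coefficients

/-- The parameters `(α, β, r, i)` of the types `(α, β, x ^ r g ^ i)` of standard elements:
`α, β` are non-zero scalars with `α ^ w = β ^ n`, and `r`, `i` are integers. -/
structure StdType (P : LiuParam k) where
  α : k
  β : k
  r : ℤ
  i : ℤ
  α_ne : α ≠ 0
  β_ne : β ≠ 0
  rel : α ^ P.w = β ^ P.n

namespace StdType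
variable {P : LiuParam k} (τ : StdType P)

open Classical in
/-- The index `m` of the last vector of the basis `v_0, …, v_m` of `V(α, β, x ^ r g ^ i)`:
`m = n - φ(-i - j)` if `β = γ ^ j` for an integer `j`, and `m = n - 1` otherwise
(that is, if `β ^ n ≠ 1`). -/
noncomputable def top : ℕ :=
  if h : ∃ j : ℤ, τ.β = P.γ ^ j then P.n - phi P.n (-τ.i - h.choose) else P.n - 1

lemma top_cases : (τ.β ^ P.n = 1 ∧ τ.top + 1 ≤ P.n ∧ τ.β = P.γ ^ (τ.top - τ.i : ℤ)) ∨
    (τ.β ^ P.n ≠ 1 ∧ τ.top + 1 = P.n) := by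
  have hn := P.n_pos
  rw [top]
  split_ifs with h
  · left
    have hj := h.choose_spec
    generalize h.choose = j at hj ⊢
    obtain ⟨h1, h2, t, ht⟩ := phi_spec P.n_pos (-τ.i - j)
    have hγ : ∀ s : ℤ, P.γ ^ ((P.n : ℤ) * s) = 1 := by
      intro s; rw [zpow_mul, zpow_natCast, P.prim.pow_eq_one, one_zpow]
    refine ⟨?_, by omega, ?_⟩
    · rw [hj, ← zpow_natCast, ← zpow_mul, mul_comm, hγ]
    · rw [hj, Nat.cast_sub h2, ht,
        show (P.n : ℤ) - (-τ.i - j + P.n * t) - τ.i = j + P.n * (1 - t) by ring,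
        zpow_add₀ (γ_ne P), hγ, mul_one]
  · right
    refine ⟨fun hβ => h ?_, by omega⟩
    have : NeZero P.n := ⟨P.n_pos.ne'⟩
    obtain ⟨j, _, hj⟩ := P.prim.eq_pow_of_pow_eq_one hβ
    exact ⟨j, by rw [zpow_natCast, hj]⟩

end StdType

/-- The vector space underlying `V(α, β, x ^ r g ^ i)`, with basis `v_0, …, v_m`. -/
def StdModule {P : LiuParam k} (τ : StdType P) : Type _ := Fin (τ.top + 1) →₀ k

namespace StdModule
variable {P : LiuParam k} (τ : StdType P)

noncomputable instance : AddCommGroup (StdModule τ) :=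
  inferInstanceAs (AddCommGroup (Fin (τ.top + 1) →₀ k))

noncomputable instance : Module k (StdModule τ) :=
  inferInstanceAs (Module k (Fin (τ.top + 1) →₀ k))

/-- The basis `v_0, …, v_m`. -/
noncomputable def basis : Module.Basis (Fin (τ.top + 1)) k (StdModule τ) :=
  ⟨LinearEquiv.refl k (Fin (τ.top + 1) →₀ k)⟩

/-- The operators by which the generators of `B(n, w, γ)` act on `V(α, β, x ^ r g ^ i)`:
`x v_a = α v_a`, `g v_a = β γ ^ (-a) v_a`, `y v_a = v_{a + 1}` for `a < m` and
`y v_m = (1 - β ^ n) v_0`. -/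
noncomputable def actGen : LiuGen → Module.End k (StdModule τ)
  | .x => τ.α • LinearMap.id
  | .xInv => τ.α⁻¹ • LinearMap.id
  | .g => (basis τ).constr k fun a => (τ.β * (P.γ ^ (a : ℕ))⁻¹) • basis τ a
  | .y => (basis τ).constr k fun a =>
      if h : (a : ℕ) < τ.top then basis τ ⟨a + 1, by omega⟩
      else (1 - τ.β ^ P.n) • basis τ 0

/-- The basis vector `v_a`, extended by `0` to `a > m`. -/
noncomputable def vec (a : ℕ) : StdModule τ :=
  if h : a < τ.top + 1 then basis τ ⟨a, h⟩ else 0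

lemma basis_eq (a : Fin (τ.top + 1)) : basis τ a = vec τ a := by
  rw [vec, dif_pos a.2]

lemma ext_vec {M : Type*} [AddCommGroup M] [Module k M] {f f' : StdModule τ →ₗ[k] M}
    (h : ∀ a : ℕ, a ≤ τ.top → f (vec τ a) = f' (vec τ a)) : f = f' :=
  (basis τ).ext fun a => by rw [basis_eq]; exact h a (by omega)

lemma actGen_g_vec (a : ℕ) : actGen τ .g (vec τ a) = (τ.β * (P.γ ^ a)⁻¹) • vec τ a := by
  rw [vec]
  split_ifs with h
  · simp [actGen]
  · simp

lemma actGen_y_vec {a : ℕ} (h : a < τ.top) : actGen τ .y (vec τ a) = vec τ (a + 1) := by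
  rw [vec, dif_pos (by omega), vec, dif_pos (by omega), actGen, Module.Basis.constr_basis]
  exact dif_pos h

lemma actGen_y_top : actGen τ .y (vec τ τ.top) = (1 - τ.β ^ P.n) • vec τ 0 := by
  rw [vec, dif_pos (by omega), vec, dif_pos (by omega), actGen, Module.Basis.constr_basis]
  exact dif_neg (lt_irrefl _)

lemma actGen_y_pow {a b : ℕ} (h : a + b ≤ τ.top) :
    (actGen τ .y ^ b) (vec τ a) = vec τ (a + b) := by
  induction b with
  | zero => simp
  | succ b ih =>
    rw [pow_succ', Module.End.mul_apply, ih (by omega), actGen_y_vec τ (by omega), add_assoc]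

lemma actGen_y_pow_top (a : ℕ) (h : a ≤ τ.top) :
    (actGen τ .y ^ (τ.top + 1)) (vec τ a) = (1 - τ.β ^ P.n) • vec τ a := by
  obtain ⟨b, hb⟩ := Nat.exists_eq_add_of_le h
  rw [show τ.top + 1 = a + (1 + b) by omega, pow_add, pow_add, Module.End.mul_apply,
    Module.End.mul_apply, actGen_y_pow τ (by omega), ← hb, pow_one, actGen_y_top, map_smul,
    actGen_y_pow τ (by omega), zero_add]

lemma actGen_y_pow_n : actGen τ .y ^ P.n = (1 - τ.β ^ P.n) • LinearMap.id := by
  refine ext_vec τ fun a ha => ?_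
  rcases τ.top_cases with ⟨h1, h2, -⟩ | ⟨-, h2⟩
  · rw [show P.n = (P.n - (τ.top + 1)) + (τ.top + 1) by omega, pow_add, Module.End.mul_apply,
      actGen_y_pow_top τ a ha, ← show P.n = (P.n - (τ.top + 1)) + (τ.top + 1) by omega, h1]
    simp
  · rw [← h2, actGen_y_pow_top τ a ha, h2]
    simp

lemma actGen_sat : Sat P (actGen τ) where
  h₁ := by
    refine LinearMap.ext fun v => ?_
    simp [actGen, smul_smul, τ.α_ne]
  h₂ := by
    refine LinearMap.ext fun v => ?_
    simp [actGen, smul_smul, τ.α_ne]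
  h₃ := LinearMap.ext fun v => by simp [actGen]
  h₄ := LinearMap.ext fun v => by simp [actGen]
  h₅ := by
    have hne := γ_ne P
    refine ext_vec τ fun a ha => ?_
    rw [Module.End.mul_apply, LinearMap.smul_apply, Module.End.mul_apply, actGen_g_vec, map_smul]
    rcases ha.eq_or_lt with rfl | ha
    · rw [actGen_y_top, map_smul, actGen_g_vec, smul_smul, smul_smul, smul_smul]
      congr 1
      rcases τ.top_cases with ⟨h1, -, -⟩ | ⟨-, h2⟩
      · rw [h1]; ring
      · have h3 := P.prim.pow_eq_one
        rw [← h2, pow_succ] at h3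
        rw [inv_eq_of_mul_eq_one_right h3]
        simp
        ring
    · rw [actGen_y_vec τ ha, actGen_g_vec, smul_smul]
      congr 1
      field_simp
      ring
  h₆ := by
    rw [actGen_y_pow_n, ← τ.rel]
    refine LinearMap.ext fun v => ?_
    simp [actGen, smul_pow, sub_smul, ← Module.End.one_eq_id]
  h₇ := by
    congr 1
    have hg : ∀ b a : ℕ, (actGen τ .g ^ b) (vec τ a) = (τ.β * (P.γ ^ a)⁻¹) ^ b • vec τ a := by
      intro b a
      induction b with
      | zero => simp
      | succ b ih =>
        rw [pow_succ', Module.End.mul_apply, ih, map_smul, actGen_g_vec, smul_smul, pow_succ]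
    refine ext_vec τ fun a _ => ?_
    rw [hg, mul_pow, inv_pow, ← pow_mul, mul_comm a, pow_mul, P.prim.pow_eq_one, one_pow, inv_one,
      mul_one, ← τ.rel]
    simp [actGen, smul_pow, ← Module.End.one_eq_id]

/-- The representation of `B(n, w, γ)` on `V(α, β, x ^ r g ^ i)`. -/
noncomputable def rep : GenLiu P →ₐ[k] Module.End k (StdModule τ) :=
  GenLiu.lift (actGen τ) (actGen_sat τ)

noncomputable instance : Module (GenLiu P) (StdModule τ) :=
  Module.compHom (StdModule τ) (rep τ).toRingHom

lemma smul_def (h : GenLiu P) (v : StdModule τ) : h • v = rep τ h v := rfl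

lemma gen_smul (a : LiuGen) (v : StdModule τ) : gen P a • v = actGen τ a v := by
  rw [smul_def, rep, GenLiu.lift_gen]

instance : IsScalarTower k (GenLiu P) (StdModule τ) where
  smul_assoc c h v := by rw [smul_def, smul_def, map_smul, LinearMap.smul_apply]

/-- The coaction `δ(v_a) = ∑_{l ≤ a} c_β^{r,i}(a, l) ⊗ v_l`; recall that `c_β^{r,i}(a, l) = 0` for
`l > a`. -/
noncomputable def coact : StdModule τ →ₗ[k] GenLiu P ⊗[k] StdModule τ :=
  (basis τ).constr k fun a => ∑ l : Fin (τ.top + 1), coef P τ.β τ.r τ.i a l ⊗ₜ basis τ l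

lemma coact_vec {a : ℕ} (h : a ≤ τ.top) : coact τ (vec τ a) =
    ∑ l ∈ Finset.range (τ.top + 1), coef P τ.β τ.r τ.i a l ⊗ₜ vec τ l := by
  rw [vec, dif_pos (by omega), coact, Module.Basis.constr_basis, Finset.sum_range]
  simp only [basis_eq]

lemma comul_grpLike (r i : ℤ) :
    comul (R := k) (grpLike P r i) = grpLike P r i ⊗ₜ[k] grpLike P r i := by
  let d : GenLiu P →* GenLiu P ⊗[k] GenLiu P :=
    { toFun := fun h => h ⊗ₜ h
      map_one' := Algebra.TensorProduct.one_def.symm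
      map_mul' := fun a b => (Algebra.TensorProduct.tmul_mul_tmul a b a b).symm }
  let f : GenLiu P →* GenLiu P ⊗[k] GenLiu P := (comulHom P : GenLiu P →* GenLiu P ⊗[k] GenLiu P)
  have hx : Units.map f (xU P) = Units.map d (xU P) := Units.ext (comulHom_gen P .x)
  have hg : Units.map f (gU P) = Units.map d (gU P) := Units.ext (comulHom_gen P .g)
  have h : Units.map f (xU P ^ r * gU P ^ i) = Units.map d (xU P ^ r * gU P ^ i) := by
    rw [map_mul, map_zpow, map_zpow, hx, hg, map_mul, map_zpow, map_zpow]
  exact congrArg Units.val h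

lemma counit_grpLike (r i : ℤ) : counit (R := k) (grpLike P r i) = 1 := by
  let f : GenLiu P →* k := (counitHom P : GenLiu P →* k)
  have hx : Units.map f (xU P) = 1 := Units.ext (counitHom_gen P .x)
  have hg : Units.map f (gU P) = 1 := Units.ext (counitHom_gen P .g)
  have h : Units.map f (xU P ^ r * gU P ^ i) = 1 := by
    rw [map_mul, map_zpow, map_zpow, hx, hg, one_zpow, one_zpow, one_mul]
  exact congrArg Units.val h

lemma counit_coef (β : k) (r i : ℤ) (a l : ℕ) :
    counit (R := k) (coef P β r i a l) = if a = l then 1 else 0 := by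
  have hy : counit (R := k) (y P) = 0 := counitHom_gen P .y
  have hg : counit (R := k) (g P) = 1 := counitHom_gen P .g
  induction a generalizing l with
  | zero =>
    rcases l with _ | l
    · simpa [coef] using counit_grpLike r i
    · simp [coef]
  | succ a ih =>
    rcases l with _ | l
    · simp [coef, hy]
    · simp [coef, hy, hg, ih]

/-- The matrix `(c_β^{r,i}(a, l))` is a comatrix. -/
lemma comul_coef (β : k) (r i : ℤ) (a l N : ℕ) (hN : a ≤ N) :
    comul (R := k) (coef P β r i a l) =
      ∑ p ∈ Finset.range (N + 1), coef P β r i a p ⊗ₜ[k] coef P β r i p l := by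
  have hne := γ_ne P
  have cSg : comul (R := k) (antipode k (g P)) = antipode k (g P) ⊗ₜ antipode k (g P) := by
    have h1 : comul (R := k) (g P) = g P ⊗ₜ g P := comulHom_gen P .g
    have h2 : comul (R := k) (gInv P) * comul (R := k) (g P) = 1 := by
      rw [← Bialgebra.comul_mul, gInv_mul_g, Bialgebra.comul_one]
    have h3 : comul (R := k) (g P) * (gInv P ⊗ₜ[k] gInv P) = 1 := by
      rw [h1, Algebra.TensorProduct.tmul_mul_tmul, g_mul_gInv, Algebra.TensorProduct.one_def]
    rw [antipode_g]
    exact left_inv_eq_right_inv h2 h3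
  have cy : comul (R := k) (y P) = y P ⊗ₜ g P + 1 ⊗ₜ y P := comulHom_gen P .y
  have cSy : comul (R := k) (antipode k (y P)) =
      antipode k (y P) ⊗ₜ 1 + antipode k (g P) ⊗ₜ antipode k (y P) := by
    rw [antipode_y, map_neg, Bialgebra.comul_mul, ← antipode_g, cSg, cy, antipode_g, add_mul]
    simp [g_mul_gInv, TensorProduct.neg_tmul, TensorProduct.tmul_neg]
    abel
  induction a generalizing l N with
  | zero =>
    rw [Finset.sum_range_succ', Finset.sum_eq_zero, zero_add]
    · rcases l with _ | l
      · rw [coef]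
        exact comul_grpLike r i
      · simp [coef]
    · intro p _
      simp [coef]
  | succ a ih =>
    obtain ⟨N, rfl⟩ : ∃ M, N = M + 1 := ⟨N - 1, by omega⟩
    have key : ∀ l : ℕ, comul (R := k)
        (coef P β r i a l * antipode k (y P) +
          (β * (P.γ ^ l)⁻¹) • (y P * coef P β r i a l * antipode k (g P))) =
        ∑ p ∈ Finset.range (N + 1),
          ((coef P β r i a p * antipode k (y P) +
            (β * (P.γ ^ p)⁻¹) • (y P * coef P β r i a p * antipode k (g P))) ⊗ₜ[k]
              coef P β r i p l +
          (coef P β r i a p * antipode k (g P)) ⊗ₜ[k]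
            (coef P β r i p l * antipode k (y P) +
          (β * (P.γ ^ l)⁻¹) • (y P * coef P β r i p l * antipode k (g P)))) := by
      intro l
      rw [map_add, map_smul, Bialgebra.comul_mul, Bialgebra.comul_mul, Bialgebra.comul_mul,
        ih l N (by omega), cSg, cSy, cy, Finset.mul_sum, Finset.sum_mul, Finset.sum_mul,
        Finset.smul_sum, ← Finset.sum_add_distrib]
      refine Finset.sum_congr rfl fun p _ => ?_
      have h1 : g P * coef P β r i p l * antipode k (g P) =
          (P.γ ^ l * (P.γ ^ p)⁻¹) • coef P β r i p l := by
        rw [g_mul_coef, smul_mul_assoc, mul_assoc, antipode_g, g_mul_gInv, mul_one]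
      simp only [mul_add, add_mul, Algebra.TensorProduct.tmul_mul_tmul, mul_one, one_mul, h1,
        TensorProduct.tmul_smul, TensorProduct.add_tmul, TensorProduct.tmul_add, smul_add,
        smul_smul, TensorProduct.smul_tmul']
      rw [show β * (P.γ ^ l)⁻¹ * (P.γ ^ l * (P.γ ^ p)⁻¹) = β * (P.γ ^ p)⁻¹ by
        field_simp]
      abel
    have rhs : ∀ l : ℕ, ∑ p ∈ Finset.range (N + 1 + 1),
        coef P β r i (a + 1) p ⊗ₜ[k] coef P β r i p l =
        ∑ p ∈ Finset.range (N + 1),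
          ((coef P β r i a p * antipode k (y P) +
            (β * (P.γ ^ p)⁻¹) • (y P * coef P β r i a p * antipode k (g P))) ⊗ₜ[k]
              coef P β r i p l +
          (coef P β r i a p * antipode k (g P)) ⊗ₜ[k] coef P β r i (p + 1) l) := by
      intro l
      have hF := (Finset.sum_range_succ (fun p => (coef P β r i a p * antipode k (y P) +
          (β * (P.γ ^ p)⁻¹) • (y P * coef P β r i a p * antipode k (g P))) ⊗ₜ[k]
            coef P β r i p l) (N + 1)).symm.trans (Finset.sum_range_succ' _ (N + 1))
      rw [coef_of_lt β r i (by omega : a < N + 1)] at hF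
      simp only [zero_mul, mul_zero, smul_zero, add_zero, TensorProduct.zero_tmul] at hF
      rw [Finset.sum_add_distrib, hF, Finset.sum_range_succ' _ (N + 1)]
      simp only [coef, TensorProduct.add_tmul _ (coef P β r i a _ * antipode k (g P)),
        Finset.sum_add_distrib, pow_zero, inv_one, mul_one]
      abel
    rw [rhs]
    rcases l with _ | l
    · have := key 0
      simp only [pow_zero, inv_one, mul_one] at this
      rw [coef, this]
      simp only [coef]
    · rw [coef, map_add, key, Bialgebra.comul_mul, ih l N (by omega), cSg, Finset.sum_mul,
        ← Finset.sum_add_distrib]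
      refine Finset.sum_congr rfl fun p _ => ?_
      rw [coef, Algebra.TensorProduct.tmul_mul_tmul, TensorProduct.tmul_add _ _
        (coef P β r i p l * antipode k (g P)), add_assoc]

lemma coact_top :
    ∑ l ∈ Finset.range (τ.top + 1), coef P τ.β τ.r τ.i (τ.top + 1) l ⊗ₜ[k] vec τ l =
      (1 - τ.β ^ P.n) • ((coef P τ.β τ.r τ.i 0 0 -
        coef P τ.β τ.r τ.i τ.top τ.top * antipode k (g P)) ⊗ₜ[k] vec τ 0) := by
  have hne := γ_ne P
  rw [Finset.sum_range_succ', Finset.sum_eq_zero, zero_add]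
  · rw [TensorProduct.smul_tmul', coef_eq _ _ _ _ _ (Nat.zero_le _), coef_eq _ _ _ τ.top τ.top le_rfl,
      coef, Nat.sub_self, pow_zero, one_mul, smul_mul_assoc, antipode_g, grpLike_mul_gInv]
    congr 1
    have h1 : lam P.γ τ.β τ.i τ.top τ.top = 1 := by simp [lam]
    have h2 : lam P.γ τ.β τ.i (τ.top + 1) 0 =
        ∏ t ∈ Finset.Ico 0 (τ.top + 1), (τ.β - P.γ ^ (t - τ.i : ℤ)) := by simp [lam]
    rw [h1, h2, one_smul]
    rcases τ.top_cases with ⟨h, -, h'⟩ | ⟨-, h⟩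
    · rw [Finset.prod_eq_zero (i := τ.top) (by simp) (by rw [← h', sub_self]), h]
      simp
    · have h3 : (τ.i : ℤ) - τ.top - 1 = τ.i - P.n := by rw [← h]; push_cast; ring
      rw [h3, h, prod_root, Nat.sub_zero, y_pow]
      have h4 : x P ^ P.w * grpLike P τ.r (τ.i - P.n) = grpLike P τ.r τ.i := by
        rw [((x_central _).pow_left _).eq, ← g_pow, grpLike, grpLike]
        rw [show g P ^ P.n = ((gU P ^ (P.n : ℤ) : (GenLiu P)ˣ) : GenLiu P) by simp [gU],
          ← Units.val_mul, mul_assoc, ← zpow_add, sub_add_cancel]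
      rw [sub_mul, one_mul, h4, ← neg_sub (τ.β ^ P.n) 1, neg_smul, ← smul_neg, neg_sub]
  · intro l hl
    rw [Finset.mem_range] at hl
    rw [coef_eq _ _ _ _ _ (by omega)]
    have : lam P.γ τ.β τ.i (τ.top + 1) (l + 1) = 0 := by
      rw [lam]
      rcases τ.top_cases with ⟨-, -, h⟩ | ⟨-, h⟩
      · rw [Finset.prod_eq_zero (i := τ.top) (by simp; omega) (by rw [← h, sub_self]), mul_zero]
      · rw [h, gaussBinom_eq_zero P.prim (by omega) (by omega), zero_mul, zero_mul]
    rw [this, zero_smul, TensorProduct.zero_tmul]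

noncomputable instance : YetterDrinfeld k (GenLiu P) (StdModule τ) where
  coact := coact τ
  coassoc := by
    refine ext_vec τ fun a ha => ?_
    simp only [LinearMap.comp_apply]
    rw [coact_vec τ ha, map_sum, map_sum, map_sum]
    have h1 : ∀ l ∈ Finset.range (τ.top + 1), (coact τ).lTensor (GenLiu P)
        (coef P τ.β τ.r τ.i a l ⊗ₜ[k] vec τ l) = ∑ p ∈ Finset.range (τ.top + 1),
          coef P τ.β τ.r τ.i a l ⊗ₜ[k] (coef P τ.β τ.r τ.i l p ⊗ₜ[k] vec τ p) := by
      intro l hl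
      rw [Finset.mem_range] at hl
      rw [LinearMap.lTensor_tmul, coact_vec τ (by omega), TensorProduct.tmul_sum]
    rw [Finset.sum_congr rfl h1, Finset.sum_comm]
    refine Finset.sum_congr rfl fun l _ => ?_
    rw [LinearMap.rTensor_tmul, comul_coef _ _ _ _ _ _ ha, TensorProduct.sum_tmul, map_sum]
    simp
  counit_coact := by
    refine ext_vec τ fun a ha => ?_
    simp only [LinearMap.comp_apply]
    rw [coact_vec τ ha, map_sum, map_sum, Finset.sum_eq_single a]
    · simp [counit_coef]
    · intro b _ hb
      simp [counit_coef, hb.symm]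
    · intro h
      simp at h
      omega
  compat := by
    intro h
    suffices H : coact τ ∘ₗ rep τ h = ydTwist k (GenLiu P) (StdModule τ) h ∘ₗ coact τ from
      fun v => LinearMap.congr_fun H v
    induction h using GenLiu.induction with
    | halg c =>
      rw [Algebra.algebraMap_eq_smul_one, map_smul, map_smul, map_one, ydTwist_one]
      ext; simp
    | hmul a b ha hb =>
      rw [map_mul, ydTwist_mul, Module.End.mul_eq_comp, Module.End.mul_eq_comp,
        ← LinearMap.comp_assoc, ha, LinearMap.comp_assoc, hb, LinearMap.comp_assoc]
    | hadd a b ha hb => rw [map_add, map_add, LinearMap.comp_add, LinearMap.add_comp, ha, hb]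
    | hgen a =>
      have hrep : rep τ (gen P a) = actGen τ a := GenLiu.lift_gen ..
      rw [hrep]
      have hco : comul (R := k) (gen P a) = comulGen P a := comulHom_gen P a
      refine ext_vec τ fun b hb => ?_
      simp only [LinearMap.comp_apply]
      rw [coact_vec τ hb, map_sum]
      cases a
      · have tw : ∀ u v, ydTwist k (GenLiu P) (StdModule τ) (gen P .x) (u ⊗ₜ v) =
            u ⊗ₜ actGen τ .x v := by
          intro u v
          simp [ydTwist, hco, comulGen, gen_smul, antipode_x, ← mul_assoc, (x_central u).eq]
          simp [mul_assoc, x_mul_xInv]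
        simp only [tw]
        simp [actGen, coact_vec τ hb, Finset.smul_sum]
      · have tw : ∀ u v, ydTwist k (GenLiu P) (StdModule τ) (gen P .xInv) (u ⊗ₜ v) =
            u ⊗ₜ actGen τ .xInv v := by
          intro u v
          simp [ydTwist, hco, comulGen, gen_smul, antipode_xInv, (x_central u).eq.symm]
          simp [← mul_assoc, xInv_mul_x]
        simp only [tw]
        simp [actGen, coact_vec τ hb, Finset.smul_sum]
      · have tw : ∀ u v, ydTwist k (GenLiu P) (StdModule τ) (gen P .g) (u ⊗ₜ v) =
            (g P * u * gInv P) ⊗ₜ actGen τ .g v := by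
          intro u v
          simp [ydTwist, hco, comulGen, gen_smul, antipode_g, mul_assoc]
        rw [actGen_g_vec, map_smul, coact_vec τ hb, Finset.smul_sum]
        refine Finset.sum_congr rfl fun l _ => ?_
        have hne := γ_ne P
        rw [tw, g_mul_coef, smul_mul_assoc, mul_assoc, g_mul_gInv, mul_one, actGen_g_vec,
          TensorProduct.tmul_smul, TensorProduct.smul_tmul', TensorProduct.smul_tmul', smul_smul]
        congr 2
        field_simp
      · have tw : ∀ u v, ydTwist k (GenLiu P) (StdModule τ) (gen P .y) (u ⊗ₜ v) =
            (y P * u * antipode k (g P)) ⊗ₜ actGen τ .g v +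
              ((u * antipode k (g P)) ⊗ₜ actGen τ .y v + (u * antipode k (y P)) ⊗ₜ v) := by
          intro u v
          have hcg : comul (R := k) (g P) = comulGen P .g := comulHom_gen P _
          simp [ydTwist, hco, hcg, comulGen, gen_smul, mul_assoc, TensorProduct.tmul_add]
        have hL : ∀ l : ℕ, ydTwist k (GenLiu P) (StdModule τ) (gen P .y)
            (coef P τ.β τ.r τ.i b l ⊗ₜ vec τ l) =
            (coef P τ.β τ.r τ.i b l * antipode k (y P) +
              (τ.β * (P.γ ^ l)⁻¹) • (y P * coef P τ.β τ.r τ.i b l * antipode k (g P)))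
                ⊗ₜ vec τ l +
            (coef P τ.β τ.r τ.i b l * antipode k (g P)) ⊗ₜ actGen τ .y (vec τ l) := by
          intro l
          rw [tw, actGen_g_vec, TensorProduct.tmul_smul, TensorProduct.add_tmul,
            TensorProduct.smul_tmul']
          abel
        have hR : ∑ l ∈ Finset.range (τ.top + 1), coef P τ.β τ.r τ.i (b + 1) l ⊗ₜ[k] vec τ l =
            ∑ l ∈ Finset.range (τ.top + 1),
              (coef P τ.β τ.r τ.i b l * antipode k (y P) +
              (τ.β * (P.γ ^ l)⁻¹) • (y P * coef P τ.β τ.r τ.i b l * antipode k (g P)))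
                ⊗ₜ vec τ l +
            ∑ l ∈ Finset.range τ.top,
              (coef P τ.β τ.r τ.i b l * antipode k (g P)) ⊗ₜ actGen τ .y (vec τ l) := by
          rw [Finset.sum_range_succ', Finset.sum_range_succ' _ τ.top, add_right_comm,
            ← Finset.sum_add_distrib]
          congr 1
          · refine Finset.sum_congr rfl fun l hl => ?_
            rw [coef, TensorProduct.add_tmul, actGen_y_vec τ (by simpa using hl)]
          · simp [coef]
        rw [Finset.sum_congr rfl fun l _ => hL l, Finset.sum_add_distrib,
          Finset.sum_range_succ _ τ.top, Finset.sum_range_succ (fun l =>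
            (coef P τ.β τ.r τ.i b l * antipode k (g P)) ⊗ₜ[k] actGen τ .y (vec τ l)) τ.top,
          ← Finset.sum_range_succ _ τ.top, ← add_assoc, ← hR]
        rcases hb.eq_or_lt with rfl | hb'
        · rw [coact_top, actGen_y_top, map_smul, coact_vec τ (Nat.zero_le _),
            Finset.sum_eq_single 0, TensorProduct.tmul_smul, ← smul_add,
            ← TensorProduct.add_tmul, sub_add_cancel]
          · intro l _ hl
            rw [coef_of_lt _ _ _ (Nat.pos_of_ne_zero hl), TensorProduct.zero_tmul]
          · simp
        · rw [actGen_y_vec τ hb', coact_vec τ hb', coef_of_lt _ _ _ hb']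
          simp

end StdModule
end SimpleModules

end LiuYD

/-! Since `β` is not a root of unity, `β ^ n ≠ 1`, so the last index is `m = n - 1`. The braiding of
`V` is controlled at both ends of the basis by group-like elements. The line `k v_0` is a
subcomodule with coaction `x ^ r g ^ i`, and this element multiplies `v_0` by `q = α ^ r β ^ i`.
Dually, the coaction is triangular, so modulo `v_0, …, v_{m-1}` the vector `v_m` coacts by `x ^ r g
^ (i - m)`, and the coordinate functional of `v_m` is an eigenvector of this element with eigenvalue
`q' = α ^ r (β γ ^ (-m)) ^ (i - m)`.

In either situation a rank one braiding with scalar `q` or `q'` sits inside `V` or is a quotient of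
it. For a suitable functional `f` and vector `v` with `f v ≠ 0`, the value of `f^{⊗ N} Δ_{1^N}` at
`v ^ N` is a quantum factorial times `f(v) ^ N`. If the scalar is `1`, or is not a root of unity,
this never vanishes in characteristic `0`, and the powers of `v` are linearly independent in the
Nichols algebra. `nichols_infinite_of_subobject` and `nichols_infinite_of_quotient` are these two
criteria; both feed `nichols_infinite`.

By `α ^ w = β ^ n`, the power `q ^ (w n)` is `β` to the exponent `(n r + w i) n`, and `q' ^ (w n)`
is `β` to the exponent `(n r + w i - w (n - 1)) n`. If `n r + w i ≠ 0`, then `q` is not a root of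
unity. If `n r + w i = 0` and `n ≠ 1`, then `q'` is not a root of unity. If `n r + w i = 0` and `n =
1`, then `q = 1`. -/

namespace LiuYD

section YetterDrinfeld
open Coalgebra HopfAlgebra

/-! ### Components of degree zero and one in the tensor algebra. -/

section TensorAlgebra
variable {k V : Type*} [Field k] [AddCommGroup V] [Module k V]

/-- The comultiplication of `T(V)` is known through `Δ(1)` and `Δ(v t)` only, so induction has to
add one vector at a time on the left. Closure under left multiplication by every `a` is proved by
ordinary induction on `a` and then applied to `1`. -/
lemma tensorAlgebra_left_induction {C : TensorAlgebra k V → Prop} (h1 : C 1)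
    (hsmul : ∀ (c : k) t, C t → C (c • t)) (hadd : ∀ s t, C s → C t → C (s + t))
    (hmul : ∀ v t, C t → C (TensorAlgebra.ι k v * t)) (t : TensorAlgebra k V) : C t := by
  suffices h : ∀ a t : TensorAlgebra k V, C t → C (a * t) by simpa using h t 1 h1
  intro a
  induction a using TensorAlgebra.induction with
  | algebraMap r => intro t ht; rw [← Algebra.smul_def]; exact hsmul r t ht
  | ι v => exact hmul v
  | mul a b ha hb => intro t ht; rw [mul_assoc]; exact ha _ (hb _ ht)
  | add a b ha hb => intro t ht; rw [add_mul]; exact hadd _ _ (ha _ ht) (hb _ ht)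

lemma algebraMapInv_ι (v : V) : TensorAlgebra.algebraMapInv (TensorAlgebra.ι k v) = 0 := by
  simp [TensorAlgebra.algebraMapInv]

lemma ιInv_one : (TensorAlgebra.ιInv (1 : TensorAlgebra k V) : V) = 0 := by
  -- `TensorAlgebra.ιInv` passes through the square-zero extension of `k` by `V`, which needs a
  -- right action; this is the one used in its definition.
  let : Module kᵐᵒᵖ V := Module.compHom _ ((RingHom.id k).fromOpposite mul_comm)
  have : IsCentralScalar k V := ⟨fun r m => rfl⟩
  simp [TensorAlgebra.ιInv]

/-- In the square-zero extension `k ⊕ V` the product of `(0, v)` with `(ε(t), π₁(t))` is `(0, ε(t)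
v)`. -/
lemma ιInv_ι_mul (v : V) (t : TensorAlgebra k V) :
    TensorAlgebra.ιInv (TensorAlgebra.ι k v * t) = TensorAlgebra.algebraMapInv t • v := by
  let : Module kᵐᵒᵖ V := Module.compHom _ ((RingHom.id k).fromOpposite mul_comm)
  have : IsCentralScalar k V := ⟨fun r m => rfl⟩
  have hfst : (TrivSqZeroExt.fstHom k k V).comp TensorAlgebra.toTrivSqZeroExt =
      (TensorAlgebra.algebraMapInv : TensorAlgebra k V →ₐ[k] k) := by
    ext v; simp [TensorAlgebra.algebraMapInv]
  have h := AlgHom.congr_fun hfst t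
  simp only [AlgHom.comp_apply, TrivSqZeroExt.fstHom_apply] at h
  rw [← h]
  simp [TensorAlgebra.ιInv]

end TensorAlgebra

/-! ### The diagonal action of `H` on `T(V)` in degrees zero and one. -/

section Action
variable (k H V : Type*) [Field k] [Ring H] [HopfAlgebra k H]
  [AddCommGroup V] [Module k V] [Module H V] [IsScalarTower k H V]

variable {V} in
lemma tensorAct_one (h : H) : tensorAct k H V h 1 = algebraMap k _ (counit h) := by
  simp [tensorAct]

lemma tensorAct_ι (h : H) (v : V) :
    tensorAct k H V h (TensorAlgebra.ι k v) = TensorAlgebra.ι k (h • v) := by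
  simp [tensorAct, tensorActConv]

lemma tensorAct_mul (h : H) (s t : TensorAlgebra k V) :
    tensorAct k H V h (s * t) = LinearMap.mul' k _ (TensorProduct.map
      ((tensorAct k H V).flip s) ((tensorAct k H V).flip t) (comul (R := k) h)) := by
  simp [tensorAct, LinearMap.convMul_apply]

lemma one_tensorAct (t : TensorAlgebra k V) : tensorAct k H V 1 t = t := by
  induction t using tensorAlgebra_left_induction with
  | h1 => simp [tensorAct_one]
  | hsmul c t ht => rw [map_smul, ht]
  | hadd s t hs ht => rw [map_add, hs, ht]
  | hmul v t ht => simp [tensorAct_mul, Algebra.TensorProduct.one_def, tensorAct_ι, ht]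

/-- The action preserves degrees: each term of `h • (v t)` again starts with a vector, hence is
killed by the counit of `T(V)`. -/
lemma algebraMapInv_tensorAct (h : H) (t : TensorAlgebra k V) :
    TensorAlgebra.algebraMapInv (tensorAct k H V h t) =
      counit (R := k) h * TensorAlgebra.algebraMapInv t := by
  induction t using tensorAlgebra_left_induction with
  | h1 => rw [tensorAct_one, AlgHom.commutes]; simp
  | hsmul c t ht => rw [map_smul, map_smul, ht, map_smul]; simp [mul_left_comm]
  | hadd s t hs ht => rw [map_add, map_add, hs, ht, map_add, mul_add]
  | hmul v t ht =>
    rw [map_mul (TensorAlgebra.algebraMapInv (R := k) (M := V)), algebraMapInv_ι, zero_mul, mul_zero,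
      tensorAct_mul]
    generalize comul (R := k) h = z
    induction z using TensorProduct.induction_on with
    | zero => simp
    | tmul a b => simp [tensorAct_ι, algebraMapInv_ι]
    | add a b ha hb => rw [map_add, map_add, map_add, ha, hb, add_zero]

/-- The degree one part of `(h₍₁₎ • v) (h₍₂₎ • t)` is `ε(h₍₂₎) ε(t) h₍₁₎ • v`, and the counit law of
`H` collapses it to `ε(t) h • v`. The coproduct is replaced by an arbitrary tensor so that this can
be checked on pure tensors. -/
lemma ιInv_tensorAct (h : H) (t : TensorAlgebra k V) :
    TensorAlgebra.ιInv (tensorAct k H V h t) = h • (TensorAlgebra.ιInv t : V) := by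
  induction t using tensorAlgebra_left_induction with
  | h1 => rw [tensorAct_one, Algebra.algebraMap_eq_smul_one, map_smul, ιInv_one, smul_zero, smul_zero]
  | hsmul c t ht => rw [map_smul, map_smul, ht, map_smul, smul_algebra_smul_comm]
  | hadd s t hs ht => rw [map_add, map_add, hs, ht, map_add, smul_add]
  | hmul v t ht =>
    rw [tensorAct_mul, ιInv_ι_mul]
    have key : ∀ z : H ⊗[k] H, TensorAlgebra.ιInv (LinearMap.mul' k _ (TensorProduct.map
        ((tensorAct k H V).flip (TensorAlgebra.ι k v)) ((tensorAct k H V).flip t) z)) =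
        TensorAlgebra.algebraMapInv t •
          ((TensorProduct.rid k H ((counit (R := k) (A := H)).lTensor H z)) • v) := by
      intro z
      induction z using TensorProduct.induction_on with
      | zero => simp
      | tmul a b =>
        simp [tensorAct_ι, ιInv_ι_mul, algebraMapInv_tensorAct, smul_smul, mul_comm]
      | add a b ha hb => simp only [map_add, ha, hb, add_smul, smul_add]
    rw [key, Coalgebra.lTensor_counit_comul, TensorProduct.rid_tmul, one_smul,
      smul_algebra_smul_comm]

end Action

/-! ### Left multiplication by `v ⊗ 1` and `1 ⊗ v` in the braided tensor product. -/

section Braided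
variable (k H V : Type*) [Field k] [Ring H] [HopfAlgebra k H]
  [AddCommGroup V] [Module k V] [Module H V] [IsScalarTower k H V] [YetterDrinfeld k H V]

lemma braidedMul_tmul_one (s a b : TensorAlgebra k V) :
    braidedMul k H V (s ⊗ₜ 1) (a ⊗ₜ b) = (s * a) ⊗ₜ b := by
  simp [braidedMul, tensorBraiding, Algebra.TensorProduct.one_def, one_tensorAct]

/-- The map `(h ⊗ v) ↦ (h • a) ⊗ v b`. -/
noncomputable def coactMul (a b : TensorAlgebra k V) :
    H ⊗[k] V →ₗ[k] TensorAlgebra k V ⊗[k] TensorAlgebra k V :=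
  TensorProduct.map ((tensorAct k H V).flip a)
    ((LinearMap.mul k (TensorAlgebra k V)).flip b ∘ₗ TensorAlgebra.ι k)

/-- Moving `v` past `a` costs one coaction of `v`. Stating the result through a linear map on `H ⊗
V` allows later identities to be checked on pure tensors before `δ(v)` is inserted. -/
lemma braidedMul_one_tmul_ι (v : V) (a b : TensorAlgebra k V) :
    braidedMul k H V (1 ⊗ₜ TensorAlgebra.ι k v) (a ⊗ₜ b) =
      coactMul k H V a b (YetterDrinfeld.coact v) := by
  have h : tensorCoact k H V (TensorAlgebra.ι k v) =
      (TensorAlgebra.ι k).lTensor H (YetterDrinfeld.coact (k := k) (H := H) v) := by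
    simp [tensorCoact]
  simp only [braidedMul, tensorBraiding, TensorProduct.curry_apply, LinearMap.comp_apply,
    LinearEquiv.coe_coe, TensorProduct.assoc_tmul, LinearMap.lTensor_tmul,
    TensorProduct.assoc_symm_tmul, LinearMap.rTensor_tmul, AlgHom.toLinearMap_apply, h]
  generalize (YetterDrinfeld.coact v : H ⊗[k] V) = z
  induction z using TensorProduct.induction_on with
  | zero => simp
  | tmul x y => simp [coactMul]
  | add x y hx hy => simp only [map_add, TensorProduct.add_tmul, TensorProduct.tmul_add, hx, hy]

/-- The counit law `(ε ⊗ id) Δ = id` for `T(V)`. -/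
lemma counit_tensorComul (t : TensorAlgebra k V) :
    TensorProduct.lid k _ (TensorAlgebra.algebraMapInv.toLinearMap.rTensor _
      (tensorComul k H V t)) = t := by
  induction t using tensorAlgebra_left_induction with
  | h1 => simp [tensorComul_one]
  | hsmul c t ht => simp only [map_smul, ht]
  | hadd s t hs ht => simp only [map_add, hs, ht]
  | hmul v t ht =>
    rw [tensorComul_ι_mul]
    -- Writing `t` as `(ε ⊗ id) Δ(t)` makes both sides linear in `Δ(t)`, which may then be any
    -- tensor `s`. In the product, `v ⊗ 1` contributes nothing since `ε(v) = 0`, and `1 ⊗ v`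
    -- contributes `ε(v₍₋₁₎) v₍₀₎ = v` on the left.
    nth_rw 2 [← ht]
    generalize tensorComul k H V t = s
    induction s using TensorProduct.induction_on with
    | zero => simp
    | add a b ha hb => rw [map_add, map_add, map_add, ha, hb, map_add, map_add, mul_add]
    | tmul a b =>
      rw [map_add, LinearMap.add_apply, braidedMul_tmul_one, braidedMul_one_tmul_ι]
      have key : ∀ z : H ⊗[k] V, TensorProduct.lid k _
          (TensorAlgebra.algebraMapInv.toLinearMap.rTensor _ (coactMul k H V a b z)) =
          TensorAlgebra.algebraMapInv a • (TensorAlgebra.ι k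
            (TensorProduct.lid k V ((counit (R := k) (A := H)).rTensor V z)) * b) := by
        intro z
        induction z using TensorProduct.induction_on with
        | zero => simp
        | tmul x y => simp [coactMul, algebraMapInv_tensorAct, smul_smul, mul_comm]
        | add x y hx hy => simp only [map_add, hx, hy, add_mul, smul_add]
      have hc := LinearMap.congr_fun (YetterDrinfeld.counit_coact (k := k) (H := H) (V := V)) v
      simp only [LinearMap.comp_apply, LinearEquiv.coe_coe, LinearMap.id_apply] at hc
      rw [map_add, map_add, key, hc]
      simp [algebraMapInv_ι]

end Braided

/-! ### Two criteria for an infinite-dimensional Nichols algebra. -/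

section Functional
variable {k V : Type*} [Field k] [AddCommGroup V] [Module k V]

/-- The functional `f^{⊗ m}` on `V^{⊗ m}`. -/
noncomputable def tensorPowFunctional (f : V →ₗ[k] k) (m : ℕ) :
    (PiTensorProduct k fun _ : Fin m => V) →ₗ[k] k :=
  PiTensorProduct.lift ((MultilinearMap.mkPiAlgebra k (Fin m) k).compLinearMap fun _ => f)

lemma tensorPowFunctional_tprod (f : V →ₗ[k] k) (m : ℕ) (a : Fin m → V) :
    tensorPowFunctional f m (PiTensorProduct.tprod k a) = ∏ j, f (a j) := by
  simp [tensorPowFunctional]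

/-- The quantum integer `[m]_q = 1 + q + ⋯ + q ^ (m - 1)`. -/
def qInt (q : k) (m : ℕ) : k := ∑ j ∈ Finset.range m, q ^ j

lemma qInt_succ (q : k) (m : ℕ) : qInt q (m + 1) = 1 + q * qInt q m := by
  rw [qInt, Finset.sum_range_succ', qInt, Finset.mul_sum, pow_zero, add_comm]
  simp [pow_succ']

/-- For `q = 1` the quantum integer is `m` itself, nonzero in characteristic `0`; otherwise `(q - 1)
[m]_q = q ^ m - 1 ≠ 0`. -/
lemma qInt_ne_zero [CharZero k] {q : k} (hq : q = 1 ∨ ∀ m : ℕ, 0 < m → q ^ m ≠ 1) {m : ℕ}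
    (hm : 0 < m) : qInt q m ≠ 0 := by
  rcases hq with rfl | hq
  · simpa [qInt] using hm.ne'
  · intro h
    have := mul_geom_sum q m
    rw [show ∑ j ∈ Finset.range m, q ^ j = 0 from h, mul_zero] at this
    exact hq m hm (sub_eq_zero.1 this.symm)

variable (H : Type*) [Ring H] [HopfAlgebra k H] [Module H V] [IsScalarTower k H V]
  [YetterDrinfeld k H V]

/-- The functional `f^{⊗ (m + 1)} Δ_{1^{m + 1}}` on `T(V)`. -/
noncomputable def deltaFunctional (f : V →ₗ[k] k) (m : ℕ) : TensorAlgebra k V →ₗ[k] k :=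
  tensorPowFunctional f (m + 1) ∘ₗ deltaOne k H V m

lemma deltaFunctional_zero (f : V →ₗ[k] k) (t : TensorAlgebra k V) :
    deltaFunctional H f 0 t = f (TensorAlgebra.ιInv t) := by
  simp [deltaFunctional, deltaOne, iterComul, tensorPowFunctional_tprod,
    PiTensorProduct.subsingletonEquiv_symm_apply']

/-- Because `Δ^{m + 1} = (id ⊗ Δ^m) Δ`, the first tensor leg can be split off. Only the part of `Δ`
with first leg of degree one is therefore ever needed. -/
lemma deltaFunctional_succ (f : V →ₗ[k] k) (m : ℕ) (t : TensorAlgebra k V) :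
    deltaFunctional H f (m + 1) t = LinearMap.mul' k k
      (TensorProduct.map (f ∘ₗ TensorAlgebra.ιInv) (deltaFunctional H f m)
        (tensorComul k H V t)) := by
  have key : tensorPowFunctional f (m + 2) ∘ₗ PiTensorProduct.map (fun _ => TensorAlgebra.ιInv) ∘ₗ
      tensorCons k (m + 1) = LinearMap.mul' k k ∘ₗ TensorProduct.map (f ∘ₗ TensorAlgebra.ιInv)
        (tensorPowFunctional f (m + 1) ∘ₗ PiTensorProduct.map (fun _ => TensorAlgebra.ιInv)) := by
    ext a b
    simp [tensorCons_tmul_tprod, tensorPowFunctional_tprod, Fin.prod_univ_succ]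
  refine (LinearMap.congr_fun key
    ((iterComul (tensorComul k H V) m).lTensor _ (tensorComul k H V t))).trans ?_
  rw [LinearMap.comp_apply, ← LinearMap.comp_apply (TensorProduct.map _ _),
    LinearMap.map_comp_lTensor]
  rfl

/-- The powers of `v` lie in distinct degrees, and in each degree at least two a functional
vanishing on the defining ideal detects the corresponding power. Hence their classes are linearly
independent. -/
lemma nichols_infinite (f : V →ₗ[k] k) (v : V)
    (h : ∀ m, deltaFunctional H f (m + 1) (TensorAlgebra.ι k v ^ (m + 2)) ≠ 0) :
    ¬ FiniteDimensional k (NicholsAlgebra k H V) := by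
  intro hfin
  let 𝒜 : ℕ → Submodule k (TensorAlgebra k V) :=
    fun j => LinearMap.range (TensorAlgebra.ι k : V →ₗ[k] TensorAlgebra k V) ^ j
  -- The projection makes `F m` vanish on the summands of the ideal in degrees other than `m + 2`;
  -- the summand in degree `m + 2` lies in the kernel of `Δ_{1^{m + 2}}` by definition.
  let F : ℕ → TensorAlgebra k V →ₗ[k] k := fun m =>
    deltaFunctional H f (m + 1) ∘ₗ GradedAlgebra.proj 𝒜 (m + 2)
  have hF : ∀ m, nicholsIdeal k H V ≤ LinearMap.ker (F m) := by
    intro m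
    refine iSup_le fun j t ht => ?_
    obtain ⟨h1, h2⟩ := ht
    rw [LinearMap.mem_ker, LinearMap.comp_apply, GradedAlgebra.proj_apply]
    have h1' : t ∈ 𝒜 (j + 2) := h1
    by_cases hj : j = m
    · subst hj
      rw [DirectSum.decompose_of_mem_same 𝒜 h1', deltaFunctional, LinearMap.comp_apply,
        show deltaOne k H V (j + 1) t = 0 from h2, map_zero]
    · rw [DirectSum.decompose_of_mem_ne 𝒜 h1' (by omega), map_zero]
  let u : ℕ → NicholsAlgebra k H V := fun m =>
    (nicholsIdeal k H V).mkQ (TensorAlgebra.ι k v ^ (m + 2))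
  have hmem : ∀ m, TensorAlgebra.ι k v ^ (m + 2) ∈ 𝒜 (m + 2) := fun m =>
    Submodule.pow_mem_pow _ (LinearMap.mem_range_self _ v) _
  have hli : LinearIndependent k u := by
    rw [linearIndependent_iff']
    intro s c hs m hm
    have h0 := congrArg ((nicholsIdeal k H V).liftQ (F m) (hF m)) hs
    simp only [map_sum, map_smul, map_zero, u, Submodule.mkQ_apply, Submodule.liftQ_apply] at h0
    rw [Finset.sum_eq_single m] at h0
    · rw [LinearMap.comp_apply, GradedAlgebra.proj_apply,
        DirectSum.decompose_of_mem_same 𝒜 (hmem m), smul_eq_mul] at h0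
      exact (mul_eq_zero.1 h0).resolve_right (h m)
    · intro b _ hb
      rw [LinearMap.comp_apply, GradedAlgebra.proj_apply,
        DirectSum.decompose_of_mem_ne 𝒜 (hmem b) (by omega), map_zero, smul_zero]
    · exact fun h => absurd hm h
  exact Module.Finite.not_linearIndependent_of_infinite u hli

/-- A vector `v` spanning a subcomodule `k v` with coaction `v ↦ h ⊗ v` and braiding
`v ⊗ v ↦ q (v ⊗ v)`, where `q` has no vanishing quantum factorials. -/
lemma nichols_infinite_of_subobject (v : V) (hv : v ≠ 0) (h : H) (q : k)
    (hcoact : YetterDrinfeld.coact (k := k) v = h ⊗ₜ[k] v) (hact : h • v = q • v)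
    (hq : ∀ m, qInt q (m + 1) ≠ 0) : ¬ FiniteDimensional k (NicholsAlgebra k H V) := by
  obtain ⟨f, hf⟩ := Module.Projective.exists_dual_ne_zero k hv
  -- The identity says that `v ^ (m + 1)` has quantum derivative `[m + 1]_q v ^ m`. The two facts
  -- below are the two terms of the Leibniz rule behind it: `v ⊗ 1` leaves a degree one first leg
  -- only when it meets degree zero, and `1 ⊗ v` acts by `h` on the first leg.
  have hD : ∀ m : ℕ, (TensorAlgebra.ιInv : TensorAlgebra k V →ₗ[k] V).rTensor (TensorAlgebra k V)
      (tensorComul k H V (TensorAlgebra.ι k v ^ (m + 1))) =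
      qInt q (m + 1) • (v ⊗ₜ[k] (TensorAlgebra.ι k v ^ m)) := by
    have h1 : ∀ s : TensorAlgebra k V ⊗[k] TensorAlgebra k V,
        (TensorAlgebra.ιInv : TensorAlgebra k V →ₗ[k] V).rTensor (TensorAlgebra k V)
          (braidedMul k H V (TensorAlgebra.ι k v ⊗ₜ 1) s) =
        v ⊗ₜ[k] TensorProduct.lid k _ (TensorAlgebra.algebraMapInv.toLinearMap.rTensor _ s) := by
      intro s
      induction s using TensorProduct.induction_on with
      | zero => simp
      | add a b ha hb => simp only [map_add, ha, hb, TensorProduct.tmul_add]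
      | tmul a b => simp [braidedMul_tmul_one, ιInv_ι_mul, TensorProduct.smul_tmul]
    have h2 : ∀ s : TensorAlgebra k V ⊗[k] TensorAlgebra k V,
        (TensorAlgebra.ιInv : TensorAlgebra k V →ₗ[k] V).rTensor (TensorAlgebra k V)
          (braidedMul k H V (1 ⊗ₜ TensorAlgebra.ι k v) s) =
        TensorProduct.map (Algebra.lsmul k k V h)
          (LinearMap.mul k (TensorAlgebra k V) (TensorAlgebra.ι k v))
          ((TensorAlgebra.ιInv : TensorAlgebra k V →ₗ[k] V).rTensor (TensorAlgebra k V) s) := by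
      intro s
      induction s using TensorProduct.induction_on with
      | zero => simp
      | add a b ha hb => simp only [map_add, ha, hb]
      | tmul a b => simp [braidedMul_one_tmul_ι, hcoact, coactMul, ιInv_tensorAct]
    intro m
    rw [pow_succ', tensorComul_ι_mul, map_add, LinearMap.add_apply, map_add, h1, h2,
      counit_tensorComul]
    induction m with
    | zero => simp [tensorComul_one, ιInv_one, qInt]
    | succ m ih =>
      -- The induction runs on the expanded identity, so its hypothesis is folded back. The step is
      -- then `[m + 2]_q = 1 + q [m + 1]_q`.
      have ih' : (TensorAlgebra.ιInv : TensorAlgebra k V →ₗ[k] V).rTensor (TensorAlgebra k V)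
          (tensorComul k H V (TensorAlgebra.ι k v ^ (m + 1))) =
          qInt q (m + 1) • (v ⊗ₜ[k] (TensorAlgebra.ι k v ^ m)) := by
        rw [pow_succ', tensorComul_ι_mul, map_add, LinearMap.add_apply, map_add, h1, h2,
          counit_tensorComul, ih]
      rw [ih', map_smul, TensorProduct.map_tmul, qInt_succ q (m + 1), add_smul, one_smul]
      simp only [Algebra.lsmul_coe, hact, LinearMap.mul_apply', ← pow_succ',
        TensorProduct.smul_tmul', smul_smul, mul_comm q]
  -- By `hD`, each split-off leg yields a factor `[m + 2]_q f(v)`, so the values are quantum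
  -- factorials times powers of `f(v)`.
  have hval : ∀ m, deltaFunctional H f m (TensorAlgebra.ι k v ^ (m + 1)) ≠ 0 := by
    intro m
    induction m with
    | zero => simpa [deltaFunctional_zero, TensorAlgebra.ι_leftInverse v] using hf
    | succ m ih =>
      have e : TensorProduct.map (f ∘ₗ TensorAlgebra.ιInv) (deltaFunctional H f m) =
          TensorProduct.map f (deltaFunctional H f m) ∘ₗ
            (TensorAlgebra.ιInv : TensorAlgebra k V →ₗ[k] V).rTensor (TensorAlgebra k V) :=
        (LinearMap.map_comp_rTensor ..).symm
      rw [deltaFunctional_succ, e, LinearMap.comp_apply, hD]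
      simpa using ⟨hq _, hf, ih⟩
  exact nichols_infinite H f v fun m => hval (m + 1)

/-- A functional `f` with `(id ⊗ f) δ = f(-) h` and `f (h • v) = q f(v)`, where `q` has no
vanishing quantum factorials. -/
lemma nichols_infinite_of_quotient (f : V →ₗ[k] k) (hf : f ≠ 0) (h : H) (q : k)
    (hcoact : ∀ v, TensorProduct.rid k H (f.lTensor H (YetterDrinfeld.coact v)) = f v • h)
    (hact : ∀ v, f (h • v) = q * f v) (hq : ∀ m, qInt q (m + 1) ≠ 0) :
    ¬ FiniteDimensional k (NicholsAlgebra k H V) := by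
  obtain ⟨v, hv⟩ : ∃ v, f v ≠ 0 := by
    by_contra! h0
    exact hf (LinearMap.ext h0)
  -- This is the passage from `T(V)` to the tensor algebra of the line `V / ker f`, identified with
  -- `k[X]`.
  let φ : TensorAlgebra k V →ₐ[k] Polynomial k := TensorAlgebra.lift k (f.smulRight Polynomial.X)
  have hφ : ∀ v, φ (TensorAlgebra.ι k v) = f v • Polynomial.X := fun v => by simp [φ]
  -- Applied to `Δ(t)`, this gives the `q`-derivative of `φ t`; `g1` and `g2` together are its
  -- twisted Leibniz rule `∂(X p) = p + q X ∂p`, scaled by `f v`.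
  let G : TensorAlgebra k V ⊗[k] TensorAlgebra k V →ₗ[k] Polynomial k :=
    (TensorProduct.lid k _).toLinearMap ∘ₗ
      TensorProduct.map (f ∘ₗ TensorAlgebra.ιInv) φ.toLinearMap
  have hG : ∀ a b, G (a ⊗ₜ b) = f (TensorAlgebra.ιInv a) • φ b := fun a b => by simp [G]
  have g1 : ∀ v s, G (braidedMul k H V (TensorAlgebra.ι k v ⊗ₜ 1) s) = f v •
      φ (TensorProduct.lid k _ (TensorAlgebra.algebraMapInv.toLinearMap.rTensor _ s)) := by
    intro v s
    induction s using TensorProduct.induction_on with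
    | zero => simp
    | add a b ha hb => simp only [map_add, ha, hb, smul_add]
    | tmul a b => simp [braidedMul_tmul_one, hG, ιInv_ι_mul, smul_smul, mul_comm]
  have g2 : ∀ v s, G (braidedMul k H V (1 ⊗ₜ TensorAlgebra.ι k v) s) =
      (q * f v) • (Polynomial.X * G s) := by
    intro v s
    induction s using TensorProduct.induction_on with
    | zero => simp
    | add a b ha hb => simp only [map_add, ha, hb, mul_add, smul_add]
    | tmul a b =>
      -- On the second leg `φ` sees `v₍₀₎` only through `f(v₍₀₎)`, so `hcoact` replaces `v₍₋₁₎` by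
      -- `f(v) h`. The kernel of `f` need not be an `H`-submodule: only the action of `h` enters.
      have key : ∀ z : H ⊗[k] V, G (coactMul k H V a b z) =
          f ((TensorProduct.rid k H (f.lTensor H z)) • (TensorAlgebra.ιInv a : V)) •
            (Polynomial.X * φ b) := by
        intro z
        induction z using TensorProduct.induction_on with
        | zero => simp
        | tmul x y => simp [coactMul, hG, ιInv_tensorAct, hφ, smul_smul, mul_comm]
        | add x y hx hy => simp only [map_add, hx, hy, add_smul]
      rw [braidedMul_one_tmul_ι, key, hcoact, hG, smul_assoc, map_smul, hact, mul_smul_comm,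
        smul_smul, smul_eq_mul]
      congr 1
      ring
  -- Coefficientwise, the `q`-derivative sends `X ^ (m + 1)` to `[m + 1]_q X ^ m`.
  have hcoeff : ∀ t m, (G (tensorComul k H V t)).coeff m = qInt q (m + 1) * (φ t).coeff (m + 1) := by
    intro t
    induction t using tensorAlgebra_left_induction with
    | h1 =>
      intro m
      simp [tensorComul_one, hG, ιInv_one, Polynomial.coeff_one]
    | hsmul c t ht => intro m; simp only [map_smul, Polynomial.coeff_smul, ht, smul_eq_mul]; ring
    | hadd s t hs ht => intro m; simp only [map_add, Polynomial.coeff_add, hs, ht]; ring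
    | hmul v t ht =>
      intro m
      rw [tensorComul_ι_mul, map_add, LinearMap.add_apply, map_add, g1, g2, counit_tensorComul,
        map_mul, hφ, smul_mul_assoc, Polynomial.coeff_add, Polynomial.coeff_smul,
        Polynomial.coeff_smul, Polynomial.coeff_smul, Polynomial.coeff_X_mul, qInt_succ]
      rcases m with _ | m
      · simp [qInt]
      · rw [Polynomial.coeff_X_mul, ht]
        simp only [smul_eq_mul]
        ring
  -- The constant built by the induction is the quantum factorial of `m + 1`.
  have hD : ∀ m, ∃ c : k, c ≠ 0 ∧ ∀ t, deltaFunctional H f m t = c * (φ t).coeff (m + 1) := by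
    intro m
    induction m with
    | zero =>
      refine ⟨1, one_ne_zero, fun t => ?_⟩
      -- Evaluation of `φ` at `0` and the counit of `T(V)` are algebra maps that both vanish on `V`.
      have h0 : ∀ t, (φ t).coeff 0 = TensorAlgebra.algebraMapInv t := by
        intro t
        have : (Polynomial.aeval (0 : k)).comp φ = TensorAlgebra.algebraMapInv := by
          ext v; simp [hφ, algebraMapInv_ι]
        rw [← this]
        simp [Polynomial.coeff_zero_eq_aeval_zero]
      rw [deltaFunctional_zero, one_mul]
      induction t using tensorAlgebra_left_induction with
      | h1 => simp [ιInv_one, Polynomial.coeff_one]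
      | hsmul c t ht => simp only [map_smul, Polynomial.coeff_smul, ht]
      | hadd s t hs ht => simp only [map_add, Polynomial.coeff_add, hs, ht]
      | hmul v t ht =>
        rw [ιInv_ι_mul, map_mul, hφ, smul_mul_assoc, Polynomial.coeff_smul,
          Polynomial.coeff_X_mul, h0, map_smul]
        simp [mul_comm]
    | succ m ih =>
      obtain ⟨c, hc, hct⟩ := ih
      refine ⟨c * qInt q (m + 2), mul_ne_zero hc (hq _), fun t => ?_⟩
      rw [deltaFunctional_succ, mul_assoc, ← hcoeff]
      generalize tensorComul k H V t = s
      induction s using TensorProduct.induction_on with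
      | zero => simp
      | add a b ha hb => simp only [map_add, ha, hb, Polynomial.coeff_add, mul_add]
      | tmul a b =>
        rw [hG, Polynomial.coeff_smul]
        simp [hct, mul_left_comm]
  refine nichols_infinite H f v fun m => ?_
  obtain ⟨c, hc, hct⟩ := hD (m + 1)
  rw [hct, map_pow, hφ, smul_pow, Polynomial.coeff_smul, Polynomial.coeff_X_pow_self]
  simpa using ⟨hc, hv⟩

end Functional
end YetterDrinfeld

/-! ### The two ends of the basis of `V(α, β, x ^ r g ^ i)` and their braiding scalars. -/

namespace StdModule
variable {k : Type*} [Field k] {P : LiuParam k} (τ : StdType P)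
open GenLiu

lemma units_zpow_smul_eq {M : Type*} [AddCommGroup M] [Module k M] [Module (GenLiu P) M]
    [IsScalarTower k (GenLiu P) M] (u : (GenLiu P)ˣ) {v : M} {c : k} (hc : c ≠ 0)
    (h : (u : GenLiu P) • v = c • v) (a : ℤ) :
    ((u ^ a : (GenLiu P)ˣ) : GenLiu P) • v = c ^ a • v := by
  have hinv : ((u⁻¹ : (GenLiu P)ˣ) : GenLiu P) • v = c⁻¹ • v := by
    rw [← Units.smul_def, inv_smul_eq_iff, Units.smul_def, smul_algebra_smul_comm, h, smul_smul,
      inv_mul_cancel₀ hc, one_smul]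
  induction a using Int.induction_on with
  | zero => simp
  | succ a ih =>
    rw [zpow_add_one, zpow_add_one₀ hc, Units.val_mul, mul_smul, h, smul_algebra_smul_comm, ih,
      smul_smul, mul_comm]
  | pred a ih =>
    rw [zpow_sub_one, zpow_sub_one₀ hc, Units.val_mul, mul_smul, hinv, smul_algebra_smul_comm, ih,
      smul_smul, mul_comm]

lemma grpLike_smul_vec (r i : ℤ) (a : ℕ) :
    grpLike P r i • vec τ a = (τ.α ^ r * (τ.β * (P.γ ^ a)⁻¹) ^ i) • vec τ a := by
  have hx : (xU P : GenLiu P) • vec τ a = τ.α • vec τ a := by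
    rw [show (xU P : GenLiu P) = gen P .x from rfl, gen_smul]
    simp [actGen]
  have hg : (gU P : GenLiu P) • vec τ a = (τ.β * (P.γ ^ a)⁻¹) • vec τ a := by
    rw [show (gU P : GenLiu P) = gen P .g from rfl, gen_smul, actGen_g_vec]
  rw [grpLike, Units.val_mul, mul_smul,
    units_zpow_smul_eq _ (mul_ne_zero τ.β_ne (inv_ne_zero (pow_ne_zero _ (γ_ne P)))) hg,
    smul_algebra_smul_comm, units_zpow_smul_eq _ τ.α_ne hx, smul_smul, mul_comm]

lemma coact_vec_zero : YetterDrinfeld.coact (k := k) (vec τ 0) =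
    grpLike P τ.r τ.i ⊗ₜ[k] vec τ 0 := by
  change coact τ (vec τ 0) = _
  rw [coact_vec τ (Nat.zero_le _), Finset.sum_eq_single 0]
  · rw [coef]
  · intro l _ hl
    rw [coef_of_lt _ _ _ (Nat.pos_of_ne_zero hl), TensorProduct.zero_tmul]
  · simp

/-- The coordinate functional of the last basis vector `v_m`. -/
noncomputable def topCoord : StdModule τ →ₗ[k] k := (basis τ).coord ⟨τ.top, by omega⟩

lemma topCoord_vec {a : ℕ} (h : a ≤ τ.top) :
    topCoord τ (vec τ a) = if a = τ.top then 1 else 0 := by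
  rw [vec, dif_pos (by omega), topCoord, Module.Basis.coord_apply, Module.Basis.repr_self,
    Finsupp.single_apply]
  simp

/-- The matrix `c(a, l)` is triangular, so in the last column only the diagonal entry `c(m, m)`
survives. Its scalar `lam` is an empty product times a Gaussian binomial equal to `1`, which leaves
the group-like element `x ^ r g ^ (i - m)`. -/
lemma topCoord_coact (v : StdModule τ) :
    TensorProduct.rid k (GenLiu P) ((topCoord τ).lTensor (GenLiu P)
      (YetterDrinfeld.coact v)) = topCoord τ v • grpLike P τ.r (τ.i - τ.top) := by
  suffices h : (TensorProduct.rid k (GenLiu P)).toLinearMap ∘ₗ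
      (topCoord τ).lTensor (GenLiu P) ∘ₗ coact τ =
      (topCoord τ).smulRight (grpLike P τ.r (τ.i - τ.top)) from LinearMap.congr_fun h v
  refine ext_vec τ fun a ha => ?_
  simp only [LinearMap.comp_apply, LinearMap.smulRight_apply]
  rw [coact_vec τ ha, map_sum, map_sum, Finset.sum_eq_single τ.top]
  · rw [LinearMap.lTensor_tmul, topCoord_vec τ le_rfl, topCoord_vec τ ha, LinearEquiv.coe_coe,
      TensorProduct.rid_tmul, if_pos rfl, one_smul]
    split_ifs with h
    · rw [h, coef_eq _ _ _ _ _ le_rfl]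
      simp [lam]
    · rw [coef_of_lt _ _ _ (by omega), zero_smul]
  · intro l hl h
    rw [Finset.mem_range] at hl
    rw [LinearMap.lTensor_tmul, topCoord_vec τ (by omega), if_neg h]
    simp
  · simp

/-- Group-like elements `x ^ r g ^ i` act diagonally in the basis, so every coordinate functional is
an eigenvector for them. -/
lemma topCoord_grpLike_smul (r i : ℤ) (v : StdModule τ) : topCoord τ (grpLike P r i • v) =
    τ.α ^ r * (τ.β * (P.γ ^ τ.top)⁻¹) ^ i * topCoord τ v := by
  suffices h : topCoord τ ∘ₗ rep τ (grpLike P r i) =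
      (τ.α ^ r * (τ.β * (P.γ ^ τ.top)⁻¹) ^ i) • topCoord τ from LinearMap.congr_fun h v
  refine ext_vec τ fun a ha => ?_
  rw [LinearMap.comp_apply, ← smul_def, grpLike_smul_vec, map_smul, LinearMap.smul_apply,
    topCoord_vec τ ha]
  split_ifs with h
  · rw [h]
  · simp

/-- The self-braiding scalar of a vector on which `x`, `g` act by `α`, `β γ ^ (-a)`. -/
lemma braiding_scalar_pow (r i : ℤ) (a : ℕ) :
    (τ.α ^ r * (τ.β * (P.γ ^ a)⁻¹) ^ i) ^ (P.w * P.n) = τ.β ^ ((P.n * r + P.w * i) * P.n) := by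
  have hγ : (P.γ ^ a)⁻¹ ^ P.n = 1 := by
    rw [inv_pow, ← pow_mul, mul_comm, pow_mul, P.prim.pow_eq_one, one_pow, inv_one]
  -- The factor `w` of the exponent turns `α` into a power of `β` through `α ^ w = β ^ n`; the
  -- factor `n` removes the root of unity `γ ^ a` in `h2`.
  have h1 : (τ.α ^ r) ^ (P.w * P.n) = τ.β ^ (P.n * r * P.n : ℤ) := by
    calc (τ.α ^ r) ^ (P.w * P.n) = ((τ.α ^ P.w) ^ r) ^ P.n := by
          rw [pow_mul, ← zpow_natCast _ P.w, ← zpow_natCast _ P.w, ← zpow_mul, ← zpow_mul,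
            mul_comm r]
      _ = _ := by
          rw [τ.rel, ← zpow_natCast, ← zpow_natCast τ.β, ← zpow_mul, ← zpow_mul, mul_assoc]
  have h2 : ((τ.β * (P.γ ^ a)⁻¹) ^ i) ^ (P.w * P.n) = τ.β ^ (P.w * i * P.n : ℤ) := by
    calc ((τ.β * (P.γ ^ a)⁻¹) ^ i) ^ (P.w * P.n) = (((τ.β * (P.γ ^ a)⁻¹) ^ P.n) ^ i) ^ P.w := by
          rw [mul_comm P.w, pow_mul, ← zpow_natCast _ P.n, ← zpow_natCast _ P.n, ← zpow_mul,
            ← zpow_mul, mul_comm i]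
      _ = _ := by
          rw [mul_pow, hγ, mul_one, ← zpow_natCast, ← zpow_natCast τ.β, ← zpow_mul, ← zpow_mul]
          congr 1
          ring
  rw [mul_pow, h1, h2, ← zpow_add₀ τ.β_ne, add_mul]

lemma zpow_ne_one_of_not_root {b : k} (hb : ¬ ∃ m : ℕ, 0 < m ∧ b ^ m = 1) {e : ℤ} (he : e ≠ 0) :
    b ^ e ≠ 1 := by
  intro h
  refine hb ⟨e.natAbs, Int.natAbs_pos.2 he, ?_⟩
  rcases Int.natAbs_eq e with h' | h' <;> rw [h'] at h
  · exact_mod_cast h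
  · rw [zpow_neg, inv_eq_one] at h
    exact_mod_cast h

/-- If the scalar had `m`-th power `1`, raising to the power `w n` would give `β ^ ((n r + w i) n m)
= 1` with a nonzero exponent. -/
lemma braiding_scalar_pow_ne_one (hβ : ¬ ∃ m : ℕ, 0 < m ∧ τ.β ^ m = 1) (r i : ℤ) (a : ℕ)
    (h : P.n * r + P.w * i ≠ 0) {m : ℕ} (hm : 0 < m) :
    (τ.α ^ r * (τ.β * (P.γ ^ a)⁻¹) ^ i) ^ m ≠ 1 := by
  have hn := P.n_pos
  intro h1
  refine zpow_ne_one_of_not_root hβ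
    (mul_ne_zero (mul_ne_zero h (by omega : (P.n : ℤ) ≠ 0)) (by omega : (m : ℤ) ≠ 0)) ?_
  rw [zpow_mul, ← braiding_scalar_pow, zpow_natCast, pow_right_comm, h1, one_pow]

/-- The exponents `n r + w i` at `v_0` and `n r + w (i - m)` at `v_m` differ by `w (n - 1)`, so they
vanish together only for `n = 1`. The quotient criterion is used exactly when the first exponent
vanishes and `n ≠ 1`. -/
lemma nicholsAlgebra_infinite [CharZero k] (hβ : ¬ ∃ m : ℕ, 0 < m ∧ τ.β ^ m = 1) :
    ¬ FiniteDimensional k (NicholsAlgebra k (GenLiu P) (StdModule τ)) := by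
  have hn := P.n_pos
  have hw := P.w_pos
  have htop : τ.top + 1 = P.n := by
    rcases τ.top_cases with ⟨h, -⟩ | ⟨-, h⟩
    · exact absurd ⟨P.n, hn, h⟩ hβ
    · exact h
  by_cases h : P.n * τ.r + P.w * τ.i = 0 ∧ P.n ≠ 1
  · refine nichols_infinite_of_quotient (GenLiu P) (topCoord τ) ?_ _ _ (topCoord_coact τ)
      (topCoord_grpLike_smul τ _ _) fun m => qInt_ne_zero (.inr fun m hm => ?_) m.succ_pos
    · intro h0
      have := topCoord_vec τ le_rfl
      simp [h0] at this
    · refine braiding_scalar_pow_ne_one τ hβ _ _ _ ?_ hm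
      -- The exponent attached to `v_m` reduces to `-w m`, where `m = n - 1` is positive.
      rw [mul_sub, ← add_sub_assoc, h.1, zero_sub, neg_ne_zero]
      exact mul_ne_zero (by omega) (by omega)
  · refine nichols_infinite_of_subobject (GenLiu P) (vec τ 0) ?_ _ _ (coact_vec_zero τ)
      (grpLike_smul_vec τ _ _ _) fun m => qInt_ne_zero ?_ m.succ_pos
    · rw [vec, dif_pos (by omega)]
      exact (basis τ).ne_zero _
    · by_cases h0 : P.n * τ.r + P.w * τ.i = 0
      -- For `n = 1` the relation reads `α ^ w = β`, so the scalar is `α ^ (r + w i) = α ^ 0 = 1`.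
      · left
        have h1 : P.n = 1 := by tauto
        have hrel := τ.rel
        rw [h1, pow_one] at hrel
        rw [h1, Nat.cast_one, one_mul] at h0
        rw [pow_zero, inv_one, mul_one, ← hrel, ← zpow_natCast, ← zpow_mul, ← zpow_add₀ τ.α_ne, h0,
          zpow_zero]
      · exact .inr fun m hm => braiding_scalar_pow_ne_one τ hβ _ _ _ h0 hm

end StdModule
end LiuYD

/-- If `α` and `β` are not roots of unity, the Nichols algebra of the simple Yetter-Drinfeld module
`V(α, β, x ^ r g ^ i)` over the generalized Liu algebra `B(n, w, γ)` is infinite-dimensional. -/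
theorem lemma5p6 {k : Type*} [Field k] [IsAlgClosed k] [CharZero k] (P : LiuYD.LiuParam k)
    (τ : LiuYD.StdType P)
    (hα : ¬ ∃ m : ℕ, 0 < m ∧ τ.α ^ m = 1) (hβ : ¬ ∃ m : ℕ, 0 < m ∧ τ.β ^ m = 1) :
    ¬ FiniteDimensional k
      (LiuYD.NicholsAlgebra k (LiuYD.GenLiu P) (LiuYD.StdModule τ)) :=
  LiuYD.StdModule.nicholsAlgebra_infinite τ hβ
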